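/- A Young function is a convex, left-continuous $f:[0,\infty)\to[0,\infty]$ with $f(0)=0$, $\lim_{x\to\infty}f(x)=\infty$ and $f(x_0)<\infty$ for some $x_0>0$. For Young functions $f_1,\dots,f_n$ let $K_f=\{x\in\mathbb{R}^n:\sum_{i=1}^n f_i(|x_i|)\le 1\}$; the Musielak–Orlicz space $X$ with coordinate functions $f_1,\dots,f_n$ is $\mathbb{R}^n$ with the Luxemburg norm $\|x\|=\inf\{\lambda>0: x\in\lambda K_f\}$. For real normed spaces, $d(X,Y)=\inf\|T\|\,\|T^{-1}\|$ over all linear isomorphisms $T:X\to Y$ is the Banach–Mazur distance ($\infty$ if there is no such $T$), and $e(Y)$ is the maximal cardinality of an equilateral set in $Y$, that is, of a set $S$ for which there is $p>0$ with $\|x-y\|=p$ for all distinct $x,y\in S$. **Theorem.** Let $X$ be an $n$-dimensional Musielak–Orlicz space whose coordinate functions satisfy $f_i'(0)=0$ for $i=1,\dots,n$. Then there is $R(X)>1$ such that $e(Y)\ge n$ for every normed space $Y$ with $d(X,Y)\le R(X)$. Moreover, suppose that the coordinate functions are ordered so that $f_1,\dots,f_m$ ($0\le m\le n$) are exactly those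 which do not attain the value $\frac12$; put $c_i=\sup\{x\ge0: f_i(x)<\infty\}$ for $i\le m$ and let $f_i(c_i)=\frac12$ for $i>m$. Write $f^-$ and $f^+$ for the left and right derivatives (with values in $[0,\infty]$), and let $K>0$ be a real number with $$K>\frac{f_j^-(c_j)}{f_i^+(c_i)}\qquad\text{for all } m<i<j\le n,$$ where the quotient is read as $0$ if $f_i^+(c_i)=\infty$. Then there is $\varepsilon_0$ with $0<\varepsilon_0<\min_i c_i$ such that $$\sum_{k=1}^n\frac{f_k((K+1)\varepsilon_0)}{\varepsilon_0}\le\frac{f_i(c_i)-f_i(c_i-\varepsilon_0)}{\varepsilon_0}+\frac{f_j(c_j)-f_j(c_j-\varepsilon_0)}{\varepsilon_0}\qquad (m<i<j\le n),$$ $$\sum_{k=1}^n f_k((K+1)\varepsilon_0)\le 1-f_i(c_i)-f_j(c_j)\qquad (i\le m,\ i<j\le n),$$ and, if $n\ge2$, for every such $\varepsilon_0$ the number $$R=\min_{1\le i<j\le n}\big\|(c_i+K\varepsilon_0)e_i+(c_j-\varepsilon_0)e_j\big\|$$ satisfies $R>1$, and $e(Y)\ge n$ for every normed space $Y$ with $d(X,Y)\le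 R$. -/

import Mathlib

open Filter Topology
open scoped NNReal ENNReal Pointwise

universe u

/-- A Young (coordinate) function: a convex, left-continuous `f : [0,∞) → [0,∞]` with `f 0 = 0`,
`f x → ∞` as `x → ∞`, and `f x₀ ≠ ∞` for some `x₀ > 0`. -/
structure YoungFunction where
  toFun : ℝ≥0 → ℝ≥0∞
  convex' : ConvexOn ℝ≥0 Set.univ toFun
  leftCont' : ∀ x, ContinuousWithinAt toFun (Set.Iic x) x
  map_zero' : toFun 0 = 0
  tendsto_top' : Tendsto toFun atTop (𝓝 ∞)
  exists_ne_top' : ∃ x₀, 0 < x₀ ∧ toFun x₀ ≠ ∞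

namespace YoungFunction

instance : CoeFun YoungFunction (fun _ => ℝ≥0 → ℝ≥0∞) := ⟨YoungFunction.toFun⟩

/-- The condition `f'(0) = 0` (the derivative at the endpoint `0` of `[0,∞)`). -/
def DerivZero (f : YoungFunction) : Prop :=
  Tendsto (fun t : ℝ≥0 => f t / (t : ℝ≥0∞)) (𝓝[>] 0) (𝓝 0)

/-- The right derivative at a point where `f` is finite; the limit of the difference quotients
exists in `[0,∞]` by convexity, so it is their upper limit. -/
noncomputable def rightDeriv (f : YoungFunction) (a : ℝ≥0) : ℝ≥0∞ :=
  limsup (fun h : ℝ≥0 => (f (a + h) - f a) / (h : ℝ≥0∞)) (𝓝[>] 0)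

/-- The left derivative at a point `a > 0` where `f` is finite; the limit of the difference
quotients exists in `[0,∞]` by convexity, so it is their upper limit. -/
noncomputable def leftDeriv (f : YoungFunction) (a : ℝ≥0) : ℝ≥0∞ :=
  limsup (fun h : ℝ≥0 => (f a - f (a - h)) / (h : ℝ≥0∞)) (𝓝[>] 0)

theorem map_mul_le (f : YoungFunction) {t : ℝ≥0} (ht : t ≤ 1) (x : ℝ≥0) :
    f (t * x) ≤ (t : ℝ≥0∞) * f x := by
  have h := f.convex'.2 (Set.mem_univ x) (Set.mem_univ 0) (zero_le (a := t))
    (zero_le (a := 1 - t)) (add_tsub_cancel_of_le ht)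
  simpa [f.map_zero', ENNReal.smul_def] using h

theorem mono (f : YoungFunction) : Monotone f := by
  intro x y hxy
  rcases eq_or_ne y 0 with rfl | hy
  · rw [nonpos_iff_eq_zero.mp hxy]
  · have ht : x / y ≤ 1 := div_le_one_of_le₀ hxy zero_le
    have h := f.map_mul_le ht y
    rw [div_mul_cancel₀ x hy] at h
    exact h.trans (mul_le_of_le_one_left zero_le (by exact_mod_cast ht))

theorem exists_small (f : YoungFunction) {r : ℝ≥0∞} (hr : 0 < r) :
    ∃ δ : ℝ≥0, 0 < δ ∧ f δ ≤ r := by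
  obtain ⟨x, hx, hfx⟩ := f.exists_ne_top'
  have hlim : Tendsto (fun t : ℝ≥0 => (t : ℝ≥0∞) * f x) (𝓝[>] 0) (𝓝 0) := by
    have h0 : Tendsto (fun t : ℝ≥0 => (t : ℝ≥0∞)) (𝓝 0) (𝓝 ((0 : ℝ≥0) : ℝ≥0∞)) :=
      ENNReal.tendsto_coe.2 tendsto_id
    have := ENNReal.Tendsto.mul_const (b := f x) h0 (Or.inr hfx)
    simp only [ENNReal.coe_zero, zero_mul] at this
    exact this.mono_left nhdsWithin_le_nhds
  have h1 : ∀ᶠ t : ℝ≥0 in 𝓝[>] 0, (t : ℝ≥0∞) * f x ≤ r := hlim.eventually (ge_mem_nhds hr)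
  have h2 : ∀ᶠ t : ℝ≥0 in 𝓝[>] 0, t ≤ 1 :=
    nhdsWithin_le_nhds (ge_mem_nhds zero_lt_one)
  have h3 : ∀ᶠ t : ℝ≥0 in 𝓝[>] 0, 0 < t := self_mem_nhdsWithin
  obtain ⟨t, ht1, ht2, ht3⟩ := (h1.and (h2.and h3)).exists
  exact ⟨t * x, mul_pos ht3 hx, (f.map_mul_le ht2 x).trans ht1⟩

end YoungFunction

/-- The set `K = {x ∈ ℝⁿ : ∑ f_i(|x_i|) ≤ 1}`. -/
def luxemburgBall {n : ℕ} (f : Fin n → YoungFunction) : Set (Fin n → ℝ) :=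
  {x | ∑ i, f i ‖x i‖₊ ≤ 1}

theorem luxemburgBall_convex {n : ℕ} (f : Fin n → YoungFunction) :
    Convex ℝ (luxemburgBall f) := by
  intro x hx y hy a b ha hb hab
  lift a to ℝ≥0 using ha
  lift b to ℝ≥0 using hb
  have hab' : a + b = 1 := by exact_mod_cast hab
  have key : ∀ i, f i ‖((a : ℝ) • x + (b : ℝ) • y) i‖₊
      ≤ (a : ℝ≥0∞) * f i ‖x i‖₊ + (b : ℝ≥0∞) * f i ‖y i‖₊ := by
    intro i
    have h1 : ‖((a : ℝ) • x + (b : ℝ) • y) i‖₊ ≤ a • ‖x i‖₊ + b • ‖y i‖₊ := by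
      refine (nnnorm_add_le _ _).trans (le_of_eq ?_)
      simp [nnnorm_mul]
    have h2 := (f i).convex'.2 (Set.mem_univ ‖x i‖₊) (Set.mem_univ ‖y i‖₊)
      (zero_le (a := a)) (zero_le (a := b)) hab'
    have h3 := ((f i).mono h1).trans h2
    simpa [ENNReal.smul_def] using h3
  change ∑ i, f i ‖((a : ℝ) • x + (b : ℝ) • y) i‖₊ ≤ 1
  calc ∑ i, f i ‖((a : ℝ) • x + (b : ℝ) • y) i‖₊
      ≤ ∑ i, ((a : ℝ≥0∞) * f i ‖x i‖₊ + (b : ℝ≥0∞) * f i ‖y i‖₊) :=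
        Finset.sum_le_sum fun i _ => key i
    _ = (a : ℝ≥0∞) * ∑ i, f i ‖x i‖₊ + (b : ℝ≥0∞) * ∑ i, f i ‖y i‖₊ := by
        rw [Finset.sum_add_distrib, Finset.mul_sum, Finset.mul_sum]
    _ ≤ (a : ℝ≥0∞) * 1 + (b : ℝ≥0∞) * 1 := by
        gcongr
        · exact hx
        · exact hy
    _ = 1 := by
        rw [mul_one, mul_one]
        exact_mod_cast hab'

theorem luxemburgBall_mem_nhds {n : ℕ} (f : Fin n → YoungFunction) :
    luxemburgBall f ∈ 𝓝 (0 : Fin n → ℝ) := by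
  have hr : (0 : ℝ≥0∞) < ((n : ℝ≥0∞) + 1)⁻¹ := by simp
  choose δ hδ hfδ using fun i => (f i).exists_small hr
  have h : ∀ i, ∀ᶠ x : Fin n → ℝ in 𝓝 0, ‖x i‖₊ ≤ δ i := by
    intro i
    have hc : Continuous fun x : Fin n → ℝ => ‖x i‖₊ := by fun_prop
    have h0 : Tendsto (fun x : Fin n → ℝ => ‖x i‖₊) (𝓝 0) (𝓝 0) := by
      simpa using hc.tendsto 0
    exact h0.eventually (ge_mem_nhds (hδ i))
  filter_upwards [eventually_all.2 h] with x hx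
  calc ∑ i, f i ‖x i‖₊ ≤ ∑ _i : Fin n, ((n : ℝ≥0∞) + 1)⁻¹ :=
        Finset.sum_le_sum fun i _ => ((f i).mono (hx i)).trans (hfδ i)
    _ = n * ((n : ℝ≥0∞) + 1)⁻¹ := by simp
    _ ≤ ((n : ℝ≥0∞) + 1) * ((n : ℝ≥0∞) + 1)⁻¹ := by
        gcongr
        exact le_self_add
    _ ≤ 1 := ENNReal.mul_inv_le_one _

theorem luxemburgBall_isVonNBounded {n : ℕ} (f : Fin n → YoungFunction) :
    Bornology.IsVonNBounded ℝ (luxemburgBall f) := by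
  rw [NormedSpace.isVonNBounded_iff, isBounded_iff_forall_norm_le]
  have h : ∀ i, ∃ M : ℝ≥0, 1 < f i M := fun i =>
    ((f i).tendsto_top'.eventually (lt_mem_nhds ENNReal.one_lt_top)).exists
  choose M hM using h
  refine ⟨((∑ i, M i : ℝ≥0) : ℝ), fun x hx => ?_⟩
  refine (pi_norm_le_iff_of_nonneg (NNReal.coe_nonneg _)).2 fun i => ?_
  have h1 : f i ‖x i‖₊ ≤ 1 :=
    (Finset.single_le_sum (f := fun j => f j ‖x j‖₊) (fun _ _ => zero_le)
      (Finset.mem_univ i)).trans hx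
  have h2 : ‖x i‖₊ < M i := by
    by_contra hcon
    exact absurd (((f i).mono (not_lt.mp hcon)).trans h1) (not_le.mpr (hM i))
  have h3 : ‖x i‖₊ ≤ ∑ j, M j :=
    h2.le.trans (Finset.single_le_sum (fun _ _ => zero_le) (Finset.mem_univ i))
  exact_mod_cast h3

theorem luxemburgBall_neg {n : ℕ} (f : Fin n → YoungFunction) :
    ∀ x ∈ luxemburgBall f, -x ∈ luxemburgBall f := by
  intro x hx
  simpa [luxemburgBall] using hx

theorem luxemburgBall_balanced {n : ℕ} (f : Fin n → YoungFunction) :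
    Balanced ℝ (luxemburgBall f) := by
  rw [balanced_iff_smul_mem]
  intro a ha x hx
  refine le_trans (Finset.sum_le_sum fun i _ => (f i).mono ?_) hx
  change ‖a * x i‖₊ ≤ ‖x i‖₊
  rw [nnnorm_mul]
  exact mul_le_of_le_one_left zero_le ha

/-- The vector space `ℝⁿ` of the Musielak–Orlicz space with coordinate functions `f_1, …, f_n`. It
carries the Luxemburg norm `‖x‖ = inf {r > 0 : x ∈ r K}`, the gauge of `K`. -/
def MusielakOrlicz {n : ℕ} (_f : Fin n → YoungFunction) : Type := Fin n → ℝ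

namespace MusielakOrlicz

instance {n : ℕ} (f : Fin n → YoungFunction) : AddCommGroup (MusielakOrlicz f) :=
  inferInstanceAs (AddCommGroup (Fin n → ℝ))

instance {n : ℕ} (f : Fin n → YoungFunction) : Module ℝ (MusielakOrlicz f) :=
  inferInstanceAs (Module ℝ (Fin n → ℝ))

/-- The Luxemburg norm. -/
noncomputable def luxemburgNorm {n : ℕ} (f : Fin n → YoungFunction) :
    AddGroupNorm (MusielakOrlicz f) where
  toFun x := gauge (E := Fin n → ℝ) (luxemburgBall f) x
  map_zero' := gauge_zero (E := Fin n → ℝ)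
  add_le' x y := gauge_add_le (E := Fin n → ℝ) (luxemburgBall_convex f)
    (absorbent_nhds_zero (luxemburgBall_mem_nhds f)) x y
  neg' x := gauge_neg (E := Fin n → ℝ) (luxemburgBall_neg f) x
  eq_zero_of_map_eq_zero' _ hx := (gauge_eq_zero (E := Fin n → ℝ)
    (absorbent_nhds_zero (luxemburgBall_mem_nhds f)) (luxemburgBall_isVonNBounded f)).1 hx

noncomputable instance {n : ℕ} (f : Fin n → YoungFunction) :
    NormedAddCommGroup (MusielakOrlicz f) :=
  (luxemburgNorm f).toNormedAddCommGroup

noncomputable instance {n : ℕ} (f : Fin n → YoungFunction) : NormedSpace ℝ (MusielakOrlicz f) where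
  norm_smul_le a x := by
    exact le_of_eq (gauge_smul (E := Fin n → ℝ) (luxemburgBall_balanced f) a x)

/-- The defining formula of the norm. -/
theorem norm_eq {n : ℕ} (f : Fin n → YoungFunction) (x : MusielakOrlicz f) :
    ‖x‖ = sInf {r : ℝ | 0 < r ∧ (x : Fin n → ℝ) ∈ r • luxemburgBall f} := rfl

/-- The vector `a e_i + b e_j` (used for `i ≠ j`). -/
def pairVec {n : ℕ} (f : Fin n → YoungFunction) (i j : Fin n) (a b : ℝ) : MusielakOrlicz f :=
  (Pi.single i a + Pi.single j b : Fin n → ℝ)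

end MusielakOrlicz

/-- The multiplicative Banach–Mazur distance `inf ‖T‖ ‖T⁻¹‖` over all linear isomorphisms
`T : X → Y`; it is `∞` if there is none. -/
noncomputable def banachMazurDist (X Y : Type*) [NormedAddCommGroup X] [NormedSpace ℝ X]
    [NormedAddCommGroup Y] [NormedSpace ℝ Y] : ℝ≥0∞ :=
  ⨅ T : X ≃L[ℝ] Y,
    ENNReal.ofReal (‖(T : X →L[ℝ] Y)‖ * ‖(T.symm : Y →L[ℝ] X)‖)

/-- A set is equilateral if, for some `p > 0`, any two distinct points of it are at distance `p`. -/
def IsEquilateral {Y : Type*} [NormedAddCommGroup Y] (S : Set Y) : Prop :=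
  ∃ p : ℝ, 0 < p ∧ ∀ x ∈ S, ∀ y ∈ S, x ≠ y → ‖x - y‖ = p

/-- The equilateral dimension `e(Y)`: the largest cardinality of an equilateral set. -/
noncomputable def equilateralDim (Y : Type*) [NormedAddCommGroup Y] : ℕ∞ :=
  ⨆ (S : Set Y) (_ : IsEquilateral S), S.encard

/-- The coordinate functions are ordered so that exactly the first `m` of them do not attain the
value `1/2`; `c_i` is the end of the interval of finiteness of `f_i` for these, and `f_i(c_i) = 1/2`
for the others. -/
structure HalfPoints {n : ℕ} (f : Fin n → YoungFunction) (m : ℕ) (c : Fin n → ℝ≥0) : Prop where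
  lt_iff : ∀ i : Fin n, (i : ℕ) < m ↔ ¬ ∃ x, f i x = 1 / 2
  isLUB : ∀ i : Fin n, (i : ℕ) < m → IsLUB {x | f i x < ∞} (c i)
  half : ∀ i : Fin n, m ≤ (i : ℕ) → f i (c i) = 1 / 2

/-- `K > 0` and `K > f_j⁻(c_j) / f_i⁺(c_i)` for `m < i < j ≤ n` (indices starting at `1`). In
`[0,∞]` the quotient is `0` when the right derivative `f_i⁺(c_i)` is infinite. -/
def SlopeBound {n : ℕ} (f : Fin n → YoungFunction) (m : ℕ) (c : Fin n → ℝ≥0) (K : ℝ≥0) : Prop :=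
  0 < K ∧ ∀ i j : Fin n, m ≤ (i : ℕ) → i < j →
    (f j).leftDeriv (c j) / (f i).rightDeriv (c i) < K

/-- The smallness conditions on the step `ε`. -/
structure StepBound {n : ℕ} (f : Fin n → YoungFunction) (m : ℕ) (c : Fin n → ℝ≥0) (K ε : ℝ≥0) :
    Prop where
  pos : 0 < ε
  lt : ∀ i, ε < c i
  attained : ∀ i j : Fin n, m ≤ (i : ℕ) → i < j →
    ∑ k, f k ((K + 1) * ε) / (ε : ℝ≥0∞) ≤
      (f i (c i) - f i (c i - ε)) / (ε : ℝ≥0∞) + (f j (c j) - f j (c j - ε)) / (ε : ℝ≥0∞)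
  notAttained : ∀ i j : Fin n, (i : ℕ) < m → i < j →
    ∑ k, f k ((K + 1) * ε) ≤ 1 - f i (c i) - f j (c j)

-- Let `T` satisfy `‖x‖ ≤ ‖T x‖ ≤ R ‖x‖`, put `u i = T e_i`, `a i = c i - ε` and `b = (K + 1) ε`,
-- and consider the points `p j = a j • u j - ∑ i < j, ε i j • u i` with parameters `ε i j ∈ [0,
-- b]`. For `i < j` the difference `p i - p j` has coefficient `a i + ε i j` at `i`, `-a j` at `j`,
-- and coefficients of size at most `b` elsewhere.
--
-- If `ε i j = 0`, the distance is at most `R`: lowering `c i` and `c j` by `ε` frees at least the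
-- modular that the small coordinates cost. Such an `ε` exists because this cost is `o(ε)` by `f'(0)
-- = 0`, while the gain is linear in `ε` by convexity, or there is a fixed gap below `1` when `1/2`
-- is not attained. Hence the preimage has norm at most `1`. If `ε i j = b`, the coefficient at `i`
-- is `c i + K ε`, and monotonicity of the norm gives distance at least `R`. Brouwer's theorem then
-- adjusts all parameters at once so that every distance is `R` (`exists_forall_norm_sub_eq`).
--
-- That `R > 1` is where `K` enters: by convexity the gain of `f i` over a step `K ε` exceeds the
-- loss of `f j` over a step `ε` (`one_lt_add_of_slopeBound`), and left-continuity turns modular `>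
-- 1` into norm `> 1`. For the first assertion the coordinates are permuted so that a finite `K`
-- exists.
--
-- Brouwer's theorem is proved analytically: the integral of `det (1 + t u')` over a ball is a
-- polynomial in `t`, constant for small `t`, hence also at `t = 1`, which excludes a smooth
-- retraction onto the sphere.

-- Brouwer's fixed point theorem

/-- A segment leaving the ball meets the sphere, where `u` vanishes, so the constant survives
extension by zero. -/
theorem LipschitzOnWith.indicator_ball {E F : Type*} [NormedAddCommGroup E] [NormedSpace ℝ E]
    [NormedAddCommGroup F] {u : E → F} {ρ : ℝ} {C : ℝ≥0}
    (hu : LipschitzOnWith C u (Metric.closedBall 0 ρ)) (h0 : ∀ x, ‖x‖ = ρ → u x = 0) :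
    LipschitzWith C ((Metric.ball (0 : E) ρ).indicator u) := by
  have key : ∀ x y : E, ‖x‖ < ρ → ρ ≤ ‖y‖ →
      dist ((Metric.ball (0 : E) ρ).indicator u x) ((Metric.ball (0 : E) ρ).indicator u y)
        ≤ C * dist x y := by
    intro x y hx hy
    have hc : ContinuousOn (fun t : ℝ => ‖AffineMap.lineMap (k := ℝ) x y t‖) (Set.Icc 0 1) := by
      apply Continuous.continuousOn
      exact (AffineMap.lineMap_continuous).norm
    obtain ⟨t, ht, hz⟩ := intermediate_value_Icc zero_le_one hc
      (show ρ ∈ Set.Icc _ _ by simpa using ⟨hx.le, hy⟩)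
    have h1 : dist x (AffineMap.lineMap x y t) ≤ dist x y := by
      rw [dist_left_lineMap, Real.norm_of_nonneg ht.1]
      exact mul_le_of_le_one_left dist_nonneg ht.2
    have h2 := hu.dist_le_mul x (by simpa using hx.le) (AffineMap.lineMap x y t)
      (by simpa using hz.le)
    rw [h0 _ hz] at h2
    rw [Set.indicator_of_mem (by simpa using hx), Set.indicator_of_notMem (by simpa using hy)]
    exact h2.trans (by gcongr)
  refine LipschitzWith.of_dist_le_mul fun x y => ?_
  rcases lt_or_ge ‖x‖ ρ with hx | hx <;> rcases lt_or_ge ‖y‖ ρ with hy | hy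
  · rw [Set.indicator_of_mem (by simpa using hx), Set.indicator_of_mem (by simpa using hy)]
    exact hu.dist_le_mul x (by simpa using hx.le) y (by simpa using hy.le)
  · exact key x y hx hy
  · rw [dist_comm, dist_comm x]
    exact key y x hy hx
  · rw [Set.indicator_of_notMem (by simpa using hx), Set.indicator_of_notMem (by simpa using hy)]
    simp only [dist_self]
    positivity

theorem ContinuousLinearMap.exists_polynomial_det_one_add_smul {E : Type*} [NormedAddCommGroup E]
    [NormedSpace ℝ E] [FiniteDimensional ℝ E] (A : E →L[ℝ] E) :
    ∃ p : Polynomial ℝ, p.natDegree ≤ Module.finrank ℝ E ∧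
      ∀ t : ℝ, p.eval t = (ContinuousLinearMap.id ℝ E + t • A).det := by
  classical
  let b := Module.finBasis ℝ E
  let M := LinearMap.toMatrix b b (A : E →ₗ[ℝ] E)
  refine ⟨Matrix.det ((Polynomial.X : Polynomial ℝ) • M.map Polynomial.C +
    (1 : Matrix _ _ ℝ).map Polynomial.C), ?_, fun t => ?_⟩
  · simpa using Polynomial.natDegree_det_X_add_C_le M 1
  · rw [← Polynomial.coe_evalRingHom, RingHom.map_det, ContinuousLinearMap.det,
      ← LinearMap.det_toMatrix b]
    congr 1
    ext i j
    have h1 : LinearMap.toMatrix b b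
        ((ContinuousLinearMap.id ℝ E + t • A : E →L[ℝ] E) : E →ₗ[ℝ] E) = 1 + t • M := by
      rw [← LinearMap.toMatrix_id b]
      simp only [M, ← map_smul, ← map_add]
      rfl
    rw [h1]
    clear_value M
    simp only [RingHom.mapMatrix_apply, Matrix.map_apply, Matrix.add_apply, Matrix.smul_apply,
      Matrix.one_apply, Polynomial.coe_evalRingHom, smul_eq_mul, Polynomial.eval_add,
      Polynomial.eval_mul, Polynomial.eval_X, Polynomial.eval_C]
    ring

/-- For `t ∈ [0, 1]` the operator `1 + t A` is injective, so its determinant cannot change sign on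
the way from its value `1` at `t = 0`. -/
theorem ContinuousLinearMap.det_one_add_pos {E : Type*} [NormedAddCommGroup E]
    [NormedSpace ℝ E] [FiniteDimensional ℝ E] {A : E →L[ℝ] E} (hA : ‖A‖ < 1) :
    0 < (ContinuousLinearMap.id ℝ E + A).det := by
  obtain ⟨p, -, hp⟩ := A.exists_polynomial_det_one_add_smul
  have hne : ∀ t ∈ Set.Icc (0 : ℝ) 1, p.eval t ≠ 0 := by
    intro t ht h
    rw [hp, ContinuousLinearMap.det] at h
    obtain ⟨v, hv, hv0⟩ := (Submodule.ne_bot_iff _).1 (LinearMap.bot_lt_ker_of_det_eq_zero h).ne'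
    have h1 : v = -(t • A v) := eq_neg_of_add_eq_zero_left hv
    have h2 : ‖v‖ ≤ ‖A‖ * ‖v‖ := by
      conv_lhs => rw [h1, norm_neg, norm_smul, Real.norm_of_nonneg ht.1]
      exact (mul_le_of_le_one_left (norm_nonneg _) ht.2).trans (A.le_opNorm v)
    have h3 : 0 < ‖v‖ := norm_pos_iff.2 hv0
    nlinarith
  have h0 : p.eval 0 = 1 := by
    rw [hp]
    simp [ContinuousLinearMap.det]
  by_contra hcon
  have h1 : p.eval 1 ≤ 0 := by
    rw [hp]
    simpa using hcon
  obtain ⟨t, ht, hz⟩ := intermediate_value_Icc' zero_le_one p.continuous.continuousOn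
    (show (0 : ℝ) ∈ Set.Icc _ _ from ⟨h1, by rw [h0]; exact zero_le_one⟩)
  exact hne t ht hz

theorem injective_add_smul_of_lipschitzWith {E : Type*} [NormedAddCommGroup E]
    [NormedSpace ℝ E] {u : E → E} {C : ℝ≥0} (hu : LipschitzWith C u) {t : ℝ} (ht : 0 ≤ t)
    (htC : t * C < 1) : Function.Injective fun x => x + t • u x := by
  intro x y hxy
  have h1 : x - y = t • (u y - u x) := by
    rw [smul_sub, sub_eq_sub_iff_add_eq_add, add_comm _ y]
    exact hxy
  have h2 : ‖x - y‖ ≤ t * (C * ‖x - y‖) := by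
    conv_lhs => rw [h1, norm_smul, Real.norm_of_nonneg ht, norm_sub_rev]
    gcongr
    exact hu.norm_sub_le x y
  have h3 : ‖x - y‖ = 0 := by nlinarith [norm_nonneg (x - y)]
  exact sub_eq_zero.1 (norm_eq_zero.1 h3)

theorem surjective_add_smul_of_lipschitzWith {E : Type*} [NormedAddCommGroup E]
    [NormedSpace ℝ E] [CompleteSpace E] {u : E → E} {C : ℝ≥0} (hu : LipschitzWith C u) {t : ℝ}
    (ht : 0 ≤ t) (htC : t * C < 1) : Function.Surjective fun x => x + t • u x := by
  intro y
  lift t to ℝ≥0 using ht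
  have hc : ContractingWith (t * C) fun x => y - (t : ℝ) • u x := by
    refine ⟨by exact_mod_cast htC, LipschitzWith.of_dist_le_mul fun x z => ?_⟩
    rw [dist_sub_left, dist_smul₀]
    simp only [NNReal.coe_mul, mul_assoc, NNReal.norm_eq]
    gcongr
    exact hu.dist_le_mul x z
  have h := hc.fixedPoint_isFixedPt
  exact ⟨_, (sub_eq_iff_eq_add.1 h).symm⟩

/-- The map is a bijection of the whole space and the identity outside the ball, so it must permute
the ball. -/
theorem image_ball_add_smul_of_lipschitzWith {E : Type*} [NormedAddCommGroup E]
    [NormedSpace ℝ E] [CompleteSpace E] {u : E → E} {C : ℝ≥0} {ρ : ℝ} (hu : LipschitzWith C u)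
    (h0 : ∀ x, ρ ≤ ‖x‖ → u x = 0) {t : ℝ} (ht : 0 ≤ t) (htC : t * C < 1) :
    (fun x => x + t • u x) '' Metric.ball 0 ρ = Metric.ball 0 ρ := by
  ext y
  simp only [Set.mem_image, mem_ball_zero_iff]
  constructor
  · rintro ⟨x, hx, rfl⟩
    by_contra hcon
    have h1 := h0 _ (not_lt.1 hcon)
    have h2 : x + t • u x = x :=
      injective_add_smul_of_lipschitzWith hu ht htC (by simp only [h1, smul_zero, add_zero])
    rw [h2] at hcon
    exact hcon hx
  · intro hy
    obtain ⟨x, hx⟩ := surjective_add_smul_of_lipschitzWith hu ht htC y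
    refine ⟨x, ?_, hx⟩
    by_contra hcon
    simp only [h0 x (not_lt.1 hcon), smul_zero, add_zero] at hx
    exact hcon (hx ▸ hy)

/-- The signed volume of the image of a ball under a small Lipschitz displacement. -/
theorem integral_det_one_add_smul {E : Type*} [NormedAddCommGroup E]
    [NormedSpace ℝ E] [FiniteDimensional ℝ E] [MeasurableSpace E] [BorelSpace E]
    (μ : MeasureTheory.Measure E) [μ.IsAddHaarMeasure] {u : E → E} {u' : E → E →L[ℝ] E} {ρ : ℝ}
    {C : ℝ≥0} (hu : LipschitzWith C u) (h0 : ∀ x, ρ ≤ ‖x‖ → u x = 0)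
    (hu' : ∀ x, ‖x‖ < ρ → HasFDerivAt u (u' x) x) {t : ℝ} (ht : 0 ≤ t) (htC : t * C < 1) :
    MeasureTheory.IntegrableOn (fun x => (ContinuousLinearMap.id ℝ E + t • u' x).det)
        (Metric.ball 0 ρ) μ ∧
      ∫ x in Metric.ball 0 ρ, (ContinuousLinearMap.id ℝ E + t • u' x).det ∂μ
        = μ.real (Metric.ball 0 ρ) := by
  have hd : ∀ x ∈ Metric.ball (0 : E) ρ, HasFDerivWithinAt (fun x => x + t • u x)
      (ContinuousLinearMap.id ℝ E + t • u' x) (Metric.ball 0 ρ) x := fun x hx =>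
    ((hasFDerivAt_id x).add ((hu' x (by simpa using hx)).const_smul t)).hasFDerivWithinAt
  -- Positivity removes the absolute value from the change of variables formula, leaving a
  -- polynomial in `t`.
  have hpos : ∀ x ∈ Metric.ball (0 : E) ρ,
      |(ContinuousLinearMap.id ℝ E + t • u' x).det|
        = (ContinuousLinearMap.id ℝ E + t • u' x).det := by
    intro x hx
    refine abs_of_pos (ContinuousLinearMap.det_one_add_pos ?_)
    rw [norm_smul, Real.norm_of_nonneg ht]
    refine lt_of_le_of_lt ?_ htC
    gcongr
    exact (hu' x (by simpa using hx)).le_of_lipschitz hu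
  have hinj := (injective_add_smul_of_lipschitzWith hu ht htC).injOn (s := Metric.ball (0 : E) ρ)
  have himg := image_ball_add_smul_of_lipschitzWith hu h0 ht htC
  constructor
  · have h := (MeasureTheory.integrableOn_image_iff_integrableOn_abs_det_fderiv_smul μ
      measurableSet_ball hd hinj (fun _ => (1 : ℝ))).1 (by
        rw [himg]
        exact MeasureTheory.integrableOn_const MeasureTheory.measure_ball_lt_top.ne)
    refine h.congr_fun (fun x hx => ?_) measurableSet_ball
    simp [hpos x hx]
  · have h := MeasureTheory.integral_image_eq_integral_abs_det_fderiv_smul μ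
      measurableSet_ball hd hinj (fun _ => (1 : ℝ))
    rw [himg, MeasureTheory.setIntegral_const, smul_eq_mul, mul_one] at h
    rw [h]
    refine MeasureTheory.setIntegral_congr_fun measurableSet_ball (fun x hx => ?_)
    simp [hpos x hx]

/-- A map which is the identity outside a ball cannot have vanishing Jacobian in the ball. -/
theorem exists_det_ne_zero_of_lipschitzWith {E : Type*} [NormedAddCommGroup E]
    [NormedSpace ℝ E] [FiniteDimensional ℝ E] {u : E → E} {u' : E → E →L[ℝ] E} {ρ : ℝ} {C : ℝ≥0}
    (hρ : 0 < ρ) (hu : LipschitzWith C u) (h0 : ∀ x, ρ ≤ ‖x‖ → u x = 0)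
    (hu' : ∀ x, ‖x‖ < ρ → HasFDerivAt u (u' x) x) :
    ∃ x, ‖x‖ < ρ ∧ (ContinuousLinearMap.id ℝ E + u' x).det ≠ 0 := by
  classical
  by_contra! hcon
  borelize E
  let μ : MeasureTheory.Measure E := MeasureTheory.Measure.addHaar
  let s := Finset.range (Module.finrank ℝ E + 1)
  -- Distinct nodes with `v k * C < 1`, one more than the degree bound: the determinant at `t = 1`
  -- is interpolated from small parameters.
  let v : ℕ → ℝ := fun k => (k + 1 : ℝ)⁻¹ * (C + 1 : ℝ)⁻¹
  have hC : (0 : ℝ) < C + 1 := by positivity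
  have hv0 : ∀ k, 0 ≤ v k := fun k => by positivity
  have hv1 : ∀ k, v k * C < 1 := by
    intro k
    have h1 : ((k : ℝ) + 1)⁻¹ ≤ 1 := inv_le_one_of_one_le₀ (by linarith [k.cast_nonneg (α := ℝ)])
    have h2 : ((C : ℝ) + 1)⁻¹ * C < 1 := by
      rw [inv_mul_lt_iff₀ hC]
      linarith
    calc v k * C = ((k : ℝ) + 1)⁻¹ * (((C : ℝ) + 1)⁻¹ * C) := by ring
      _ ≤ 1 * (((C : ℝ) + 1)⁻¹ * C) := by gcongr
      _ < 1 := by linarith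
  have hinj : Set.InjOn v s := by
    intro a _ b _ hab
    have h1 := mul_right_cancel₀ (inv_ne_zero hC.ne') hab
    have h2 := inv_injective h1
    exact_mod_cast add_right_cancel h2
  have hs : s.Nonempty := ⟨0, by simp [s]⟩
  have key : ∀ x, (ContinuousLinearMap.id ℝ E + u' x).det
      = ∑ k ∈ s, (ContinuousLinearMap.id ℝ E + v k • u' x).det * (Lagrange.basis s v k).eval 1 := by
    intro x
    obtain ⟨p, hp, hpe⟩ := (u' x).exists_polynomial_det_one_add_smul
    have hdeg : p.degree < s.card := by
      refine (Polynomial.degree_le_natDegree).trans_lt ?_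
      simp only [s, Finset.card_range]
      exact_mod_cast Nat.lt_succ_of_le hp
    have h1 := congrArg (Polynomial.eval 1) (Lagrange.eq_interpolate hinj hdeg)
    rw [hpe, one_smul] at h1
    rw [h1, Lagrange.interpolate_apply, Polynomial.eval_finsetSum]
    simp [hpe]
  have hint := fun k => integral_det_one_add_smul μ hu h0 hu' (hv0 k) (hv1 k)
  have h1 : ∫ x in Metric.ball (0 : E) ρ, (ContinuousLinearMap.id ℝ E + u' x).det ∂μ = 0 := by
    refine MeasureTheory.setIntegral_eq_zero_of_forall_eq_zero fun x hx => hcon x (by simpa using hx)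
  simp only [key] at h1
  rw [MeasureTheory.integral_finsetSum _ fun k _ => (hint k).1.mul_const _] at h1
  simp only [MeasureTheory.integral_mul_const, (hint _).2] at h1
  -- All nodes give the volume of the ball and the Lagrange basis sums to `1`, so the integral at `t
  -- = 1` is that volume too.
  rw [← Finset.mul_sum, ← Polynomial.eval_finsetSum, Lagrange.sum_basis hinj hs,
    Polynomial.eval_one, mul_one] at h1
  have h2 : 0 < μ.real (Metric.ball (0 : E) ρ) :=
    ENNReal.toReal_pos (Metric.measure_ball_pos μ 0 hρ).ne' MeasureTheory.measure_ball_lt_top.ne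
  exact h2.ne' h1

/-- A smooth map which is the identity far away has a zero. -/
theorem exists_eq_zero_of_contDiff {E : Type*} [NormedAddCommGroup E]
    [InnerProductSpace ℝ E] [FiniteDimensional ℝ E] {g : E → E} {ρ : ℝ} (hρ : 0 < ρ)
    (hg : ContDiff ℝ 1 g) (hid : ∀ x, ρ ≤ ‖x‖ → g x = x) : ∃ x, g x = 0 := by
  by_contra! hne
  let r : E → E := fun x => (ρ * ‖g x‖⁻¹) • g x
  have hr : ContDiff ℝ 1 r := by
    refine ContDiff.smul (contDiff_const.mul ((hg.norm ℝ hne).inv fun x => ?_)) hg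
    exact norm_ne_zero_iff.2 (hne x)
  have hrn : ∀ x, ‖r x‖ = ρ := by
    intro x
    have : ‖g x‖ ≠ 0 := norm_ne_zero_iff.2 (hne x)
    simp only [r, norm_smul, norm_mul, norm_inv, norm_norm, Real.norm_of_nonneg hρ.le]
    field_simp
  have hw : ContDiff ℝ 1 fun x => r x - x := hr.sub contDiff_id
  obtain ⟨C, hC⟩ := hw.locallyLipschitz.locallyLipschitzOn.exists_lipschitzOnWith_of_compact
    (isCompact_closedBall (0 : E) ρ)
  -- On the sphere `g` is the identity, hence so is `r`, and the displacement `r x - x` vanishes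
  -- there.
  have hL := hC.indicator_ball fun x hx => by
    simp [r, hid x hx.ge, hx, hρ.ne']
  obtain ⟨x, hx, hdet⟩ := exists_det_ne_zero_of_lipschitzWith (u' := fun x => fderiv ℝ r x - .id ℝ E)
    hρ hL (fun x hx => Set.indicator_of_notMem (by simpa using hx) _) (fun x hx => by
      have h1 : HasFDerivAt (fun x => r x - x) (fderiv ℝ r x - .id ℝ E) x :=
        ((hr.differentiable one_ne_zero x).hasFDerivAt).sub (hasFDerivAt_id x)
      refine h1.congr_of_eventuallyEq ?_
      filter_upwards [Metric.isOpen_ball.mem_nhds (show x ∈ Metric.ball 0 ρ by simpa using hx)]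
        with y hy
      exact Set.indicator_of_mem hy _)
  rw [add_sub_cancel] at hdet
  have hunit := LinearMap.isUnit_iff_isUnit_det _ |>.2 (isUnit_iff_ne_zero.2 hdet)
  obtain ⟨v, hv⟩ := ((Module.End.isUnit_iff _).1 hunit).2 (r x)
  -- The norm of `r` is constant, yet along `v`, which the derivative sends to `r x`, the squared
  -- norm would have derivative `2 ρ ^ 2`.
  have hsq : HasFDerivAt (fun y => ‖r y‖ ^ 2) (0 : E →L[ℝ] ℝ) x := by
    simp only [hrn]
    exact hasFDerivAt_const _ _
  have h2 := ((hr.differentiable one_ne_zero x).hasFDerivAt).norm_sq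
  have h3 := congrArg (fun L : E →L[ℝ] ℝ => L v) (hsq.unique h2)
  have hv' : fderiv ℝ r x v = r x := hv
  simp [hv', hrn, hρ.ne'] at h3

/-- **Brouwer's fixed point theorem** for a map with bounded range. -/
theorem exists_fixedPoint_of_bounded {E : Type*} [NormedAddCommGroup E]
    [InnerProductSpace ℝ E] [FiniteDimensional ℝ E] {f : E → E} (hf : Continuous f) {M : ℝ}
    (hM : ∀ x, ‖f x‖ ≤ M) : ∃ x, f x = x := by
  by_contra! hne
  have hM0 : 0 ≤ M := (norm_nonneg _).trans (hM 0)
  -- The cutoff is `1` up to radius `M + 1` and `0` from `M + 2` on.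
  let χ : E → ℝ := fun x => max 0 (min 1 (M + 2 - ‖x‖))
  have hχ : Continuous χ := by fun_prop
  have hχ0 : ∀ x, 0 ≤ χ x := fun x => le_max_left _ _
  have hχ1 : ∀ x, χ x ≤ 1 := fun x => max_le zero_le_one (min_le_left _ _)
  have hc : Continuous fun x => χ x • f x := hχ.smul hf
  obtain ⟨δ, hδ, hdist⟩ : ∃ δ > 0, ∀ x, ‖x‖ ≤ M + 1 → δ ≤ ‖f x - x‖ := by
    obtain ⟨z, -, hz⟩ := (isCompact_closedBall (0 : E) (M + 1)).exists_isMinOn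
      ⟨0, by simpa using by linarith⟩ ((hf.sub continuous_id).norm.continuousOn)
    exact ⟨_, norm_pos_iff.2 (sub_ne_zero.2 (hne z)), fun x hx => hz (by simpa using hx)⟩
  -- Tolerance `1` keeps a fixed point of `φ` within radius `M + 1`, where `χ = 1`; tolerance `δ`
  -- then contradicts the lower bound on `‖f x - x‖`.
  obtain ⟨φ, hφ, hφd, hφs⟩ := hc.exists_contDiff_approx 1 (ε := fun _ => min δ 1)
    continuous_const (fun _ => by positivity)
  obtain ⟨x, hx⟩ := exists_eq_zero_of_contDiff (g := fun x => x - φ x) (ρ := M + 2)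
    (by linarith) (contDiff_id.sub hφ) (fun x hx => by
      have h1 : χ x = 0 := max_eq_left ((min_le_right _ _).trans (by linarith))
      have h2 : φ x = 0 := by
        by_contra h
        exact hφs h (by simp [h1])
      simp [h2])
  have hx' : φ x = x := (sub_eq_zero.1 hx).symm
  have hd := hφd x
  rw [hx', dist_comm, dist_eq_norm] at hd
  have hn : ‖x‖ ≤ M + 1 := by
    have h1 : ‖χ x • f x‖ ≤ M := by
      rw [norm_smul, Real.norm_of_nonneg (hχ0 x)]
      exact (mul_le_of_le_one_left (norm_nonneg _) (hχ1 x)).trans (hM x)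
    have h2 : ‖x‖ ≤ ‖χ x • f x‖ + ‖χ x • f x - x‖ := by
      simpa using norm_sub_le (χ x • f x) (χ x • f x - x)
    linarith [min_le_right δ 1]
  have h1 : χ x = 1 := by
    simp only [χ]
    rw [min_eq_left (by linarith), max_eq_right zero_le_one]
  rw [h1, one_smul] at hd
  exact absurd (hdist x hn) (not_le.2 (hd.trans_le (min_le_left _ _)))

/-- **Brouwer's fixed point theorem** for a cube. -/
theorem exists_fixedPoint_of_mem_cube {ι : Type*} [Finite ι] {f : (ι → ℝ) → ι → ℝ}
    (hf : Continuous f) {b : ℝ} (hb : ∀ x i, f x i ∈ Set.Icc 0 b) : ∃ x, f x = x := by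
  have := Fintype.ofFinite ι
  let e := EuclideanSpace.equiv ι ℝ
  obtain ⟨C, hC⟩ : ∃ C, ∀ y ∈ Set.Icc (0 : ι → ℝ) (fun _ => b), ‖e.symm y‖ ≤ C := by
    obtain ⟨C, hC⟩ := isCompact_Icc.exists_bound_of_continuousOn
      (f := e.symm) (s := Set.Icc (0 : ι → ℝ) (fun _ => b)) e.symm.continuous.continuousOn
    exact ⟨C, hC⟩
  obtain ⟨x, hx⟩ := exists_fixedPoint_of_bounded (f := fun x => e.symm (f (e x)))
    (e.symm.continuous.comp (hf.comp e.continuous)) (M := C)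
    (fun x => hC _ ⟨fun i => (hb _ i).1, fun i => (hb _ i).2⟩)
  exact ⟨e x, by simpa using congrArg e hx⟩

-- Equilateral sets from fixed points

/-- A clamped shift fixes a point with `d ≠ 0` only at an end of the interval with `d` pointing
outwards; the sign conditions forbid this. -/
theorem eq_of_eq_clamp {x b d : ℝ} (hb : 0 < b) (hx : x = max 0 (min b (x + d)))
    (h0 : x = 0 → 0 ≤ d) (h1 : x = b → d ≤ 0) : d = 0 := by
  rcases le_total 0 (min b (x + d)) with h | h
  · rw [max_eq_right h] at hx
    rcases le_total b (x + d) with h' | h'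
    · rw [min_eq_left h'] at hx
      linarith [h1 hx]
    · rw [min_eq_right h'] at hx
      linarith
  · rw [max_eq_left h] at hx
    have h2 := h0 hx
    have h3 : x + d ≤ 0 := by
      rcases min_le_iff.1 h with h4 | h4
      · linarith
      · exact h4
    linarith

/-- Points `a j • u j - ∑ i < j, ε i j • u i`, with `ε i j ∈ [0, b]`, can be chosen at prescribed
mutual distance `R` if the extreme values of `ε i j` put the distances on the two sides of `R`. -/
theorem exists_forall_norm_sub_eq {n : ℕ} {Y : Type*} [NormedAddCommGroup Y] [NormedSpace ℝ Y]
    (u : Fin n → Y) (a : Fin n → ℝ) {b R : ℝ} (hb : 0 < b)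
    (hlow : ∀ i j, i < j → ∀ w : Fin n → ℝ, w i = a i → w j = -a j →
      (∀ k, k ≠ i → k ≠ j → |w k| ≤ b) → ‖∑ k, w k • u k‖ ≤ R)
    (hhigh : ∀ i j, i < j → ∀ w : Fin n → ℝ, w i = a i + b → w j = -a j →
      R ≤ ‖∑ k, w k • u k‖) :
    ∃ p : Fin n → Y, ∀ i j, i < j → ‖p i - p j‖ = R := by
  let W : (Fin n × Fin n → ℝ) → Fin n → Fin n → ℝ := fun ε j k =>
    if k = j then a j else if k < j then -ε (k, j) else 0
  let p : (Fin n × Fin n → ℝ) → Fin n → Y := fun ε j => ∑ k, W ε j k • u k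
  have hW : ∀ j k, Continuous fun ε => W ε j k := by
    intro j k
    simp only [W]
    split_ifs <;> fun_prop
  have hp : ∀ j, Continuous fun ε => p ε j := fun j =>
    continuous_finsetSum _ fun k _ => (hW j k).smul continuous_const
  -- Each parameter moves by the defect of its distance and is clamped to `[0, b]`. Pairs with `i ≥
  -- j` are carried along but never enter the points.
  have hF : Continuous fun (ε : Fin n × Fin n → ℝ) (q : Fin n × Fin n) =>
      max 0 (min b (ε q + (R - ‖p ε q.1 - p ε q.2‖))) := by
    refine continuous_pi fun q => ?_
    have h1 := ((hp q.1).sub (hp q.2)).norm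
    fun_prop
  obtain ⟨ε, hε⟩ := exists_fixedPoint_of_mem_cube hF (b := b) fun ε q =>
    ⟨le_max_left _ _, max_le hb.le (min_le_left _ _)⟩
  have hε' : ∀ q, ε q = max 0 (min b (ε q + (R - ‖p ε q.1 - p ε q.2‖))) := fun q =>
    (congrFun hε q).symm
  have hmem : ∀ q, ε q ∈ Set.Icc 0 b := fun q => by
    rw [hε' q]
    exact ⟨le_max_left _ _, max_le hb.le (min_le_left _ _)⟩
  refine ⟨p ε, fun i j hij => ?_⟩
  have hsub : p ε i - p ε j = ∑ k, (W ε i k - W ε j k) • u k := by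
    simp only [p, ← Finset.sum_sub_distrib, sub_smul]
  have hi : W ε i i - W ε j i = a i + ε (i, j) := by
    simp [W, hij.ne, hij]
  have hj : W ε i j - W ε j j = -a j := by
    simp [W, hij.ne', hij.not_gt]
  have hk : ∀ k, k ≠ i → k ≠ j → |W ε i k - W ε j k| ≤ b := by
    intro k hki hkj
    have h1 := hmem (k, i)
    have h2 := hmem (k, j)
    simp only [W, hki, hkj, if_false]
    rw [abs_le]
    split_ifs <;> constructor <;> linarith [h1.1, h1.2, h2.1, h2.2]
  have hz := eq_of_eq_clamp hb (hε' (i, j))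
    (fun h0 => by
      have h1 := hlow i j hij (fun k => W ε i k - W ε j k) (by rw [hi, h0, add_zero]) hj hk
      rw [← hsub] at h1
      exact sub_nonneg.2 h1)
    (fun h0 => by
      have h1 := hhigh i j hij (fun k => W ε i k - W ε j k) (by rw [hi, h0]) hj
      rw [← hsub] at h1
      exact sub_nonpos.2 h1)
  exact (sub_eq_zero.1 hz).symm

theorem le_equilateralDim_of_norm_sub_eq {n : ℕ} {Y : Type*} [NormedAddCommGroup Y]
    {p : Fin n → Y} {R : ℝ} (hR : 0 < R) (hp : ∀ i j, i < j → ‖p i - p j‖ = R) :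
    (n : ℕ∞) ≤ equilateralDim Y := by
  have hp' : ∀ i j, i ≠ j → ‖p i - p j‖ = R := fun i j hij => by
    rcases lt_or_gt_of_ne hij with h | h
    · exact hp i j h
    · rw [norm_sub_rev]
      exact hp j i h
  have hinj : Function.Injective p := by
    intro i j hij
    by_contra hne
    have h := hp' i j hne
    rw [hij, sub_self, norm_zero] at h
    exact hR.ne h
  have heq : IsEquilateral (Set.range p) := by
    refine ⟨R, hR, ?_⟩
    rintro _ ⟨i, rfl⟩ _ ⟨j, rfl⟩ hij
    exact hp' i j fun h => hij (by rw [h])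
  have hcard : (Set.range p).encard = n := by
    rw [← Set.image_univ, hinj.encard_image, Set.encard_univ]
    simp
  rw [← hcard]
  exact le_iSup₂ (f := fun (S : Set Y) (_ : IsEquilateral S) => S.encard) _ heq

-- Attainment of the Banach–Mazur distance

/-- The Banach–Mazur distance of a finite-dimensional space to another space is attained. -/
theorem exists_clm_of_banachMazurDist_le {X Y : Type*} [NormedAddCommGroup X] [NormedSpace ℝ X]
    [FiniteDimensional ℝ X] [NormedAddCommGroup Y] [NormedSpace ℝ Y] {R : ℝ} (hR : 0 ≤ R)
    (h : banachMazurDist X Y ≤ ENNReal.ofReal R) :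
    ∃ T : X →L[ℝ] Y, ∀ x, ‖x‖ ≤ ‖T x‖ ∧ ‖T x‖ ≤ R * ‖x‖ := by
  have key : ∀ k : ℕ, ∃ T : X →L[ℝ] Y, ∀ x, ‖x‖ ≤ ‖T x‖ ∧ ‖T x‖ ≤ (R + (k + 1 : ℝ)⁻¹) * ‖x‖ := by
    intro k
    have hk : (0 : ℝ) < (k + 1 : ℝ)⁻¹ := by positivity
    have h1 : banachMazurDist X Y < ENNReal.ofReal (R + (k + 1 : ℝ)⁻¹) :=
      h.trans_lt (ENNReal.ofReal_lt_ofReal_iff'.2 ⟨by linarith, by linarith⟩)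
    obtain ⟨T, hT⟩ := iInf_lt_iff.1 h1
    have hT' := (ENNReal.ofReal_lt_ofReal_iff'.1 hT).1
    have hinv : ∀ x, ‖x‖ ≤ ‖(T.symm : Y →L[ℝ] X)‖ * ‖T x‖ := fun x => by
      simpa using (T.symm : Y →L[ℝ] X).le_opNorm (T x)
    -- Scaling by `‖T⁻¹‖` makes the lower constant `1`; these bounds pass to a limit of operators.
    refine ⟨‖(T.symm : Y →L[ℝ] X)‖ • (T : X →L[ℝ] Y), fun x => ?_⟩
    have h2 : ‖(‖(T.symm : Y →L[ℝ] X)‖ • (T : X →L[ℝ] Y)) x‖ = ‖(T.symm : Y →L[ℝ] X)‖ * ‖T x‖ := by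
      rw [smul_apply, norm_smul, norm_norm]
      rfl
    rw [h2]
    refine ⟨hinv x, ?_⟩
    calc ‖(T.symm : Y →L[ℝ] X)‖ * ‖T x‖
        ≤ ‖(T.symm : Y →L[ℝ] X)‖ * (‖(T : X →L[ℝ] Y)‖ * ‖x‖) := by
          gcongr
          exact (T : X →L[ℝ] Y).le_opNorm x
      _ = ‖(T : X →L[ℝ] Y)‖ * ‖(T.symm : Y →L[ℝ] X)‖ * ‖x‖ := by ring
      _ ≤ (R + (k + 1 : ℝ)⁻¹) * ‖x‖ := by gcongr
  have hY : FiniteDimensional ℝ Y := by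
    obtain ⟨T, -⟩ := iInf_lt_iff.1 (h.trans_lt ENNReal.ofReal_lt_top)
    exact T.toLinearEquiv.finiteDimensional
  choose T hT using key
  have hk1 : ∀ k : ℕ, (k + 1 : ℝ)⁻¹ ≤ 1 := fun k =>
    inv_le_one_of_one_le₀ (by linarith [k.cast_nonneg (α := ℝ)])
  have hmem : ∀ k, T k ∈ Metric.closedBall (0 : X →L[ℝ] Y) (R + 1) := by
    intro k
    rw [mem_closedBall_zero_iff]
    refine ContinuousLinearMap.opNorm_le_bound _ (by linarith) fun x => (hT k x).2.trans ?_
    gcongr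
    exact hk1 k
  have : ProperSpace (X →L[ℝ] Y) := FiniteDimensional.proper ℝ _
  obtain ⟨S, -, φ, hφ, hlim⟩ := (isCompact_closedBall (0 : X →L[ℝ] Y) (R + 1)).tendsto_subseq hmem
  refine ⟨S, fun x => ?_⟩
  have h3 : Tendsto (fun k => ‖T (φ k) x‖) atTop (𝓝 ‖S x‖) :=
    (((ContinuousLinearMap.apply ℝ Y x).continuous.tendsto S).comp hlim).norm
  have h4 : Tendsto (fun k : ℕ => (R + ((φ k : ℝ) + 1)⁻¹) * ‖x‖) atTop (𝓝 ((R + 0) * ‖x‖)) := by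
    refine Tendsto.mul_const _ (tendsto_const_nhds.add ?_)
    have := (tendsto_one_div_add_atTop_nhds_zero_nat (𝕜 := ℝ)).comp hφ.tendsto_atTop
    simpa [Function.comp_def] using this
  rw [add_zero] at h4
  exact ⟨ge_of_tendsto' h3 fun k => (hT _ x).1, le_of_tendsto_of_tendsto' h3 h4 fun k => (hT _ x).2⟩

-- Slopes and half points of Young functions

namespace YoungFunction

variable (f : YoungFunction)

/-- The three-chord inequality with denominators cleared; the slope comparisons below are its
instances. -/
theorem toReal_convex {x y z : ℝ≥0} (hxy : x ≤ y) (hyz : y ≤ z) (hxz : x < z) (hz : f z ≠ ∞) :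
    ((z : ℝ) - x) * (f y).toReal ≤ (z - y) * (f x).toReal + (y - x) * (f z).toReal := by
  have hx : f x ≠ ∞ := ne_top_of_le_ne_top hz (f.mono hxz.le)
  have hpos : 0 < z - x := tsub_pos_of_lt hxz
  have hadd : (z - y) + (y - x) = z - x := tsub_add_tsub_cancel hyz hxy
  have hst : (z - y) / (z - x) + (y - x) / (z - x) = 1 := by
    rw [← add_div, hadd, div_self hpos.ne']
  have hcomb : (z - y) / (z - x) * x + (y - x) / (z - x) * z = y := by
    rw [div_mul_eq_mul_div, div_mul_eq_mul_div, ← add_div, div_eq_iff hpos.ne', ← NNReal.coe_inj]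
    push_cast [NNReal.coe_sub hyz, NNReal.coe_sub hxy, NNReal.coe_sub hxz.le]
    ring
  have h := f.convex'.2 (Set.mem_univ x) (Set.mem_univ z) (zero_le (a := (z - y) / (z - x)))
    (zero_le (a := (y - x) / (z - x))) hst
  simp only [smul_eq_mul, hcomb, ENNReal.smul_def] at h
  have h1 := ENNReal.toReal_mono (by finiteness) h
  rw [ENNReal.toReal_add (by finiteness) (by finiteness), ENNReal.toReal_mul, ENNReal.toReal_mul,
    ENNReal.coe_toReal, ENNReal.coe_toReal, NNReal.coe_div, NNReal.coe_div, NNReal.coe_sub hyz,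
    NNReal.coe_sub hxy, NNReal.coe_sub hxz.le] at h1
  have hpos' : (0 : ℝ) < z - x := sub_pos.2 (by exact_mod_cast hxz)
  calc ((z : ℝ) - x) * (f y).toReal
      ≤ (z - x) * ((z - y) / (z - x) * (f x).toReal + (y - x) / (z - x) * (f z).toReal) := by
        gcongr
    _ = (z - y) * (f x).toReal + (y - x) * (f z).toReal := by
        field_simp

theorem slope_eq_ofReal {x y h : ℝ≥0} (hx : f x ≠ ∞) (hy : f y ≠ ∞) (hh : 0 < h) :
    (f y - f x) / (h : ℝ≥0∞) = ENNReal.ofReal (((f y).toReal - (f x).toReal) / h) := by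
  rw [ENNReal.ofReal_div_of_pos (by exact_mod_cast hh),
    ENNReal.ofReal_sub _ ENNReal.toReal_nonneg, ENNReal.ofReal_toReal hx, ENNReal.ofReal_toReal hy,
    ENNReal.ofReal_coe_nnreal]

theorem rightSlope_mono {a h' h : ℝ≥0} (ha : f a ≠ ∞) (h0 : 0 < h') (hh : h' ≤ h) :
    (f (a + h') - f a) / (h' : ℝ≥0∞) ≤ (f (a + h) - f a) / (h : ℝ≥0∞) := by
  rcases eq_or_ne (f (a + h)) ∞ with htop | hne
  · rw [htop, ENNReal.top_sub ha, ENNReal.top_div_coe]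
    exact le_top
  · have hpos := h0.trans_le hh
    rw [slope_eq_ofReal f ha (ne_top_of_le_ne_top hne (f.mono (by gcongr))) h0,
      slope_eq_ofReal f ha hne hpos]
    have hc := f.toReal_convex (x := a) (y := a + h') (z := a + h) le_self_add (by gcongr)
      (lt_add_of_pos_right _ hpos) hne
    apply ENNReal.ofReal_le_ofReal
    rw [div_le_div_iff₀ (by exact_mod_cast h0) (by exact_mod_cast hpos)]
    push_cast at hc
    linarith

theorem leftSlope_anti {a h' h : ℝ≥0} (ha : f a ≠ ∞) (h0 : 0 < h') (hh : h' ≤ h) (hha : h ≤ a) :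
    (f a - f (a - h)) / (h : ℝ≥0∞) ≤ (f a - f (a - h')) / (h' : ℝ≥0∞) := by
  have hpos := h0.trans_le hh
  rw [slope_eq_ofReal f (ne_top_of_le_ne_top ha (f.mono tsub_le_self)) ha h0,
    slope_eq_ofReal f (ne_top_of_le_ne_top ha (f.mono tsub_le_self)) ha hpos]
  have hc := f.toReal_convex (x := a - h) (y := a - h') (z := a) (tsub_le_tsub_left hh a)
    tsub_le_self (tsub_lt_self (hpos.trans_le hha) hpos) ha
  apply ENNReal.ofReal_le_ofReal
  rw [div_le_div_iff₀ (by exact_mod_cast hpos) (by exact_mod_cast h0)]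
  push_cast [NNReal.coe_sub hha, NNReal.coe_sub (hh.trans hha)] at hc
  linarith

theorem leftSlope_le_rightSlope {a h' h : ℝ≥0} (ha : f a ≠ ∞) (h0 : 0 < h) (h0' : 0 < h')
    (hha : h ≤ a) :
    (f a - f (a - h)) / (h : ℝ≥0∞) ≤ (f (a + h') - f a) / (h' : ℝ≥0∞) := by
  rcases eq_or_ne (f (a + h')) ∞ with htop | hne
  · rw [htop, ENNReal.top_sub ha, ENNReal.top_div_coe]
    exact le_top
  · rw [slope_eq_ofReal f (ne_top_of_le_ne_top ha (f.mono tsub_le_self)) ha h0,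
      slope_eq_ofReal f ha hne h0']
    have hc := f.toReal_convex (x := a - h) (y := a) (z := a + h') tsub_le_self le_self_add
      (tsub_le_self.trans_lt (lt_add_of_pos_right _ h0')) hne
    apply ENNReal.ofReal_le_ofReal
    rw [div_le_div_iff₀ (by exact_mod_cast h0) (by exact_mod_cast h0')]
    push_cast [NNReal.coe_sub hha] at hc
    linarith

theorem eventually_mem_Ioc {a : ℝ≥0} (ha : 0 < a) : ∀ᶠ h : ℝ≥0 in 𝓝[>] 0, h ∈ Set.Ioc 0 a :=
  Ioc_mem_nhdsGT ha

/-- Quotients decrease as the step shrinks, so each bounds the upper limit; existence of the limit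
is not needed. -/
theorem rightDeriv_le {a h : ℝ≥0} (ha : f a ≠ ∞) (hh : 0 < h) :
    f.rightDeriv a ≤ (f (a + h) - f a) / (h : ℝ≥0∞) := by
  refine limsup_le_of_le (by isBoundedDefault) ?_
  filter_upwards [eventually_mem_Ioc hh] with h' hh'
  exact f.rightSlope_mono ha hh'.1 hh'.2

theorem le_leftDeriv {a h : ℝ≥0} (ha : f a ≠ ∞) (hh : 0 < h) (hha : h ≤ a) :
    (f a - f (a - h)) / (h : ℝ≥0∞) ≤ f.leftDeriv a := by
  refine le_limsup_of_frequently_le (Eventually.frequently ?_) (by isBoundedDefault)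
  filter_upwards [eventually_mem_Ioc hh] with h' hh'
  exact f.leftSlope_anti ha hh'.1 hh'.2 hha

theorem leftDeriv_le_rightDeriv {a : ℝ≥0} (ha : f a ≠ ∞) (h0 : 0 < a) :
    f.leftDeriv a ≤ f.rightDeriv a := by
  refine limsup_le_of_le (by isBoundedDefault) ?_
  filter_upwards [eventually_mem_Ioc h0] with h hh
  refine le_limsup_of_frequently_le (Eventually.frequently ?_) (by isBoundedDefault)
  filter_upwards [self_mem_nhdsWithin] with h' hh'
  exact f.leftSlope_le_rightSlope ha hh.1 hh' hh.2

theorem div_le_leftSlope {a h : ℝ≥0} (ha : f a ≠ ∞) (hh : 0 < h) (hha : h ≤ a) :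
    f a / (a : ℝ≥0∞) ≤ (f a - f (a - h)) / (h : ℝ≥0∞) := by
  simpa [f.map_zero'] using f.leftSlope_anti ha hh hha le_rfl

theorem leftDeriv_pos {a : ℝ≥0} (ha : f a ≠ ∞) (h0 : 0 < f a) (ha0 : 0 < a) :
    0 < f.leftDeriv a :=
  (ENNReal.div_pos h0.ne' ENNReal.coe_ne_top).trans_le
    ((f.div_le_leftSlope ha ha0 le_rfl).trans (f.le_leftDeriv ha ha0 le_rfl))

theorem pos_of_map_ne_zero {a : ℝ≥0} (h : f a ≠ 0) : 0 < a := by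
  rw [pos_iff_ne_zero]
  rintro rfl
  exact h f.map_zero'

/-- On `[c, y]` the function lies below its chord, which is still under `1/2` just right of `c`. -/
theorem exists_map_add_le_half {c y : ℝ≥0} (hc : f c < 1 / 2) (hy : c < y) (htop : f y ≠ ∞) :
    ∃ h, 0 < h ∧ f (c + h) ≤ 1 / 2 := by
  have hlim : Tendsto (fun h : ℝ≥0 => (f (c)).toReal +
      h / (y - c : ℝ) * ((f y).toReal - (f (c)).toReal)) (𝓝[>] 0)
      (𝓝 (f (c)).toReal) := by
    have : Continuous (fun h : ℝ≥0 => (f (c)).toReal +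
      h / (y - c : ℝ) * ((f y).toReal - (f (c)).toReal)) := by fun_prop
    simpa using (this.tendsto 0).mono_left nhdsWithin_le_nhds
  have hreal : (f (c)).toReal < 1 / 2 := by
    have := (ENNReal.toReal_lt_toReal (by finiteness) (by finiteness)).2 hc
    simpa using this
  obtain ⟨h, h1, h2⟩ := ((hlim.eventually (gt_mem_nhds hreal)).and
    (eventually_mem_Ioc (tsub_pos_of_lt hy))).exists
  have hle : c + h ≤ y := by
    rw [add_comm]
    exact (le_tsub_iff_right hy.le).1 h2.2
  have hconv := f.toReal_convex (x := c) (y := c + h) (z := y) le_self_add hle hy htop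
  have hpos : (0 : ℝ) < y - c := sub_pos.2 (by exact_mod_cast hy)
  have hmem : f (c + h) ≤ 1 / 2 := by
    have hfin : f (c + h) ≠ ∞ := ne_top_of_le_ne_top htop (f.mono hle)
    rw [← ENNReal.toReal_le_toReal hfin (by finiteness)]
    have h3 : (f (c + h)).toReal ≤ (f (c)).toReal +
        h / (y - c : ℝ) * ((f y).toReal - (f (c)).toReal) := by
      rw [← mul_le_mul_iff_right₀ hpos]
      refine hconv.trans (le_of_eq ?_)
      push_cast
      field_simp
      ring
    simpa using h3.trans h1.le
  exact ⟨h, h2.1, hmem⟩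

/-- Take the supremum of `{f ≤ 1/2}`. Left-continuity keeps the value at most `1/2`; if it is
smaller, a finite value further right would let the set extend. -/
theorem exists_half_or_lt_half : ∃ c : ℝ≥0, 0 < c ∧
    (f c = 1 / 2 ∨ f c < 1 / 2 ∧ ∀ y, c < y → f y = ∞) := by
  let S : Set ℝ≥0 := {x | f x ≤ 1 / 2}
  obtain ⟨δ, hδ, hδS⟩ := f.exists_small (r := 1 / 2) (by simp)
  obtain ⟨M, hM⟩ := (f.tendsto_top'.eventually
    (lt_mem_nhds (show (1 / 2 : ℝ≥0∞) < ∞ by finiteness))).exists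
  have hbdd : BddAbove S := ⟨M, fun x hx => by
    by_contra hcon
    exact absurd (hM.trans_le (f.mono (not_le.1 hcon).le)) (not_lt.2 hx)⟩
  have hc0 : 0 < sSup S := hδ.trans_le (le_csSup hbdd hδS)
  have hlt : ∀ x, x < sSup S → f x ≤ 1 / 2 := by
    intro x hx
    obtain ⟨y, hy, hxy⟩ := exists_lt_of_lt_csSup ⟨δ, hδS⟩ hx
    exact (f.mono hxy.le).trans hy
  have hc : f (sSup S) ≤ 1 / 2 := by
    have : (𝓝[<] (sSup S)).NeBot := nhdsLT_neBot_of_exists_lt ⟨0, hc0⟩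
    refine le_of_tendsto ((f.leftCont' (sSup S)).mono_left
      (nhdsWithin_mono _ Set.Iio_subset_Iic_self)) ?_
    filter_upwards [self_mem_nhdsWithin] with x hx using hlt x hx
  refine ⟨sSup S, hc0, ?_⟩
  rcases hc.eq_or_lt with h | h
  · exact Or.inl h
  refine Or.inr ⟨h, fun y hy => ?_⟩
  by_contra htop
  obtain ⟨h, h1, h2⟩ := f.exists_map_add_le_half h hy htop
  exact absurd (le_csSup hbdd h2) (not_le.2 (lt_add_of_pos_right _ h1))

theorem tendsto_map_mul_div (hf : f.DerivZero) {K : ℝ≥0} (hK : 0 < K) :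
    Tendsto (fun ε : ℝ≥0 => f (K * ε) / (ε : ℝ≥0∞)) (𝓝[>] 0) (𝓝 0) := by
  have h1 : Tendsto (fun ε : ℝ≥0 => K * ε) (𝓝[>] 0) (𝓝[>] 0) := by
    refine tendsto_nhdsWithin_iff.2 ⟨?_, ?_⟩
    · refine Tendsto.mono_left ?_ nhdsWithin_le_nhds
      simpa using (continuous_const_mul K).tendsto (0 : ℝ≥0)
    · filter_upwards [self_mem_nhdsWithin] with ε hε using mul_pos hK hε
  have h2 : Tendsto (fun ε : ℝ≥0 => (K : ℝ≥0∞) * (f (K * ε) / ((K * ε : ℝ≥0) : ℝ≥0∞))) (𝓝[>] 0)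
      (𝓝 (K * 0)) := ENNReal.Tendsto.const_mul (hf.comp h1) (Or.inr ENNReal.coe_ne_top)
  rw [mul_zero] at h2
  refine h2.congr' ?_
  filter_upwards [self_mem_nhdsWithin] with ε hε
  rw [ENNReal.coe_mul, ← mul_div_assoc, ENNReal.mul_div_mul_left _ _ (by exact_mod_cast hK.ne')
    ENNReal.coe_ne_top]

end YoungFunction

-- Modular estimates at the half points

namespace HalfPoints

variable {n : ℕ} {f : Fin n → YoungFunction} {m : ℕ} {c : Fin n → ℝ≥0}

theorem lt_half (h : HalfPoints f m c) {i : Fin n} (hi : (i : ℕ) < m) :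
    f i (c i) < 1 / 2 ∧ ∀ y, c i < y → f i y = ∞ := by
  have hne := (h.lt_iff i).1 hi
  obtain ⟨d, -, hd | ⟨hd1, hd2⟩⟩ := (f i).exists_half_or_lt_half
  · exact absurd ⟨d, hd⟩ hne
  · have hlub : IsLUB {x | f i x < ∞} d := by
      refine ⟨fun x hx => ?_, fun b hb => hb (hd1.trans (by finiteness))⟩
      by_contra hcon
      exact absurd (hd2 x (not_le.1 hcon)) hx.ne
    rw [(h.isLUB i hi).unique hlub]
    exact ⟨hd1, hd2⟩

theorem le_half (h : HalfPoints f m c) (i : Fin n) : f i (c i) ≤ 1 / 2 := by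
  rcases lt_or_ge (i : ℕ) m with hi | hi
  · exact (h.lt_half hi).1.le
  · exact (h.half i hi).le

theorem pos (h : HalfPoints f m c) (i : Fin n) : 0 < c i := by
  rcases lt_or_ge (i : ℕ) m with hi | hi
  · obtain ⟨x, hx, hfx⟩ := (f i).exists_ne_top'
    exact hx.trans_le ((h.isLUB i hi).1 (lt_top_iff_ne_top.2 hfx))
  · exact (f i).pos_of_map_ne_zero (by rw [h.half i hi]; simp)

theorem exists_stepBound (h : HalfPoints f m c) (hf : ∀ i, (f i).DerivZero) (K : ℝ≥0) :
    ∃ ε, StepBound f m c K ε := by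
  have hlim : Tendsto (fun ε : ℝ≥0 => ∑ k, f k ((K + 1) * ε) / (ε : ℝ≥0∞)) (𝓝[>] 0) (𝓝 0) := by
    simpa using tendsto_finsetSum Finset.univ fun k _ =>
      (f k).tendsto_map_mul_div (hf k) (show 0 < K + 1 by positivity)
  have h1 : ∀ᶠ ε : ℝ≥0 in 𝓝[>] 0, ∀ i, ε < c i := by
    refine eventually_all.2 fun i => ?_
    exact nhdsWithin_le_nhds (gt_mem_nhds (h.pos i))
  -- The chord slope from `0` is a positive lower bound, independent of `ε`, for the left difference
  -- quotient at `c i`.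
  have h2 : ∀ᶠ ε : ℝ≥0 in 𝓝[>] 0, ∀ i : Fin n, m ≤ (i : ℕ) →
      ∑ k, f k ((K + 1) * ε) / (ε : ℝ≥0∞) ≤ f i (c i) / (c i : ℝ≥0∞) := by
    refine eventually_all.2 fun i => eventually_imp_distrib_left.2 fun hi => ?_
    refine hlim.eventually (ge_mem_nhds (ENNReal.div_pos ?_ ENNReal.coe_ne_top))
    rw [h.half i hi]
    simp
  -- Stronger than required: the division by `ε` is dropped at the end using `ε ≤ 1`.
  have h3 : ∀ᶠ ε : ℝ≥0 in 𝓝[>] 0, ∀ i j : Fin n, (i : ℕ) < m →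
      ∑ k, f k ((K + 1) * ε) / (ε : ℝ≥0∞) ≤ 1 - f i (c i) - f j (c j) := by
    refine eventually_all.2 fun i => eventually_all.2 fun j =>
      eventually_imp_distrib_left.2 fun hi => ?_
    refine hlim.eventually (ge_mem_nhds ?_)
    rw [tsub_tsub, tsub_pos_iff_lt, ← ENNReal.add_halves 1]
    exact ENNReal.add_lt_add_of_lt_of_le (ne_top_of_le_ne_top (by finiteness) (h.le_half j))
      (h.lt_half hi).1 (h.le_half j)
  obtain ⟨ε, hε, h1, h2, h3⟩ :=
    ((YoungFunction.eventually_mem_Ioc zero_lt_one).and (h1.and (h2.and h3))).exists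
  refine ⟨ε, hε.1, h1, fun i j hi _ => ?_, fun i j hi _ => ?_⟩
  · refine (h2 i hi).trans (le_trans ((f i).div_le_leftSlope ?_ hε.1 (h1 i).le) le_self_add)
    exact ne_top_of_le_ne_top (by finiteness) (h.le_half i)
  · refine (Finset.sum_le_sum fun k _ => ?_).trans (h3 i j hi)
    rw [ENNReal.le_div_iff_mul_le (Or.inl (by exact_mod_cast hε.1.ne'))
      (Or.inl ENNReal.coe_ne_top)]
    exact mul_le_of_le_one_right zero_le (by exact_mod_cast hε.2)

end HalfPoints

/-- The modular of `(c_i + K ε) e_i + (c_j - ε) e_j` exceeds `1`. -/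
theorem one_lt_add_of_slopeBound {n : ℕ} {f : Fin n → YoungFunction} {m : ℕ} {c : Fin n → ℝ≥0}
    {K ε : ℝ≥0} (h : HalfPoints f m c) (hK : SlopeBound f m c K) (hε : 0 < ε) {i j : Fin n}
    (hij : i < j) (hj : ε ≤ c j) : 1 < f i (c i + K * ε) + f j (c j - ε) := by
  have hKε : 0 < K * ε := mul_pos hK.1 hε
  rcases lt_or_ge (i : ℕ) m with hi | hi
  · rw [(h.lt_half hi).2 _ (lt_add_of_pos_right _ hKε), top_add]
    exact ENNReal.one_lt_top
  have hmj : m ≤ (j : ℕ) := hi.trans (by exact_mod_cast hij.le)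
  have hfi := h.half i hi
  have hfj := h.half j hmj
  have hfi' : f i (c i) ≠ ∞ := by rw [hfi]; finiteness
  have hfj' : f j (c j) ≠ ∞ := by rw [hfj]; finiteness
  have hr := (f i).rightDeriv_le hfi' hKε
  have hl := (f j).le_leftDeriv hfj' hε hj
  have hrpos : 0 < (f i).rightDeriv (c i) :=
    ((f i).leftDeriv_pos hfi' (by rw [hfi]; simp) (h.pos i)).trans_le
      ((f i).leftDeriv_le_rightDeriv hfi' (h.pos i))
  rcases eq_or_ne (f i (c i + K * ε)) ∞ with htop | hne
  · rw [htop, top_add]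
    exact ENNReal.one_lt_top
  -- A finite value beyond `c i` excludes the case where the quotient is `0` by convention, so
  -- `SlopeBound` can be multiplied out.
  have hrtop : (f i).rightDeriv (c i) ≠ ∞ :=
    ne_top_of_le_ne_top (ENNReal.div_ne_top (ne_top_of_le_ne_top hne tsub_le_self)
      (by exact_mod_cast hKε.ne')) hr
  have hlt := (ENNReal.div_lt_iff (Or.inl hrpos.ne') (Or.inl hrtop)).1 (hK.2 i j hi hij)
  have hB : f j (c j - ε) ≤ 1 / 2 := hfj ▸ (f j).mono tsub_le_self
  have hA : 1 / 2 ≤ f i (c i + K * ε) := hfi ▸ (f i).mono le_self_add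
  have h1 : (1 / 2 - f j (c j - ε)) / ε < (f i (c i + K * ε) - 1 / 2) / ε := by
    calc (1 / 2 - f j (c j - ε)) / ε ≤ (f j).leftDeriv (c j) := hfj ▸ hl
      _ < K * (f i).rightDeriv (c i) := hlt
      _ ≤ K * ((f i (c i + K * ε) - f i (c i)) / ((K * ε : ℝ≥0) : ℝ≥0∞)) := by gcongr
      _ = (f i (c i + K * ε) - 1 / 2) / ε := by
        rw [ENNReal.coe_mul, ← mul_div_assoc,
          ENNReal.mul_div_mul_left _ _ (by exact_mod_cast hK.1.ne') ENNReal.coe_ne_top, hfi]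
  have h2 : 1 / 2 - f j (c j - ε) < f i (c i + K * ε) - 1 / 2 := by
    by_contra hcon
    exact absurd h1 (not_lt.2 (ENNReal.div_le_div_right (not_lt.1 hcon) _))
  have hBtop : f j (c j - ε) ≠ ∞ := ne_top_of_le_ne_top (by finiteness) hB
  calc (1 : ℝ≥0∞) = 1 / 2 - f j (c j - ε) + f j (c j - ε) + 1 / 2 := by
        rw [tsub_add_cancel_of_le hB, ENNReal.add_halves]
    _ < f i (c i + K * ε) - 1 / 2 + f j (c j - ε) + 1 / 2 := by
        refine ENNReal.add_lt_add_right (by finiteness) ?_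
        exact ENNReal.add_lt_add_right hBtop h2
    _ = f i (c i + K * ε) + f j (c j - ε) := by
        rw [add_right_comm, tsub_add_cancel_of_le hA]

/-- The modular at the lower ends of the parameters is at most `1`. -/
theorem add_sum_le_one_of_stepBound {n : ℕ} {f : Fin n → YoungFunction} {m : ℕ} {c : Fin n → ℝ≥0}
    {K ε : ℝ≥0} (h : HalfPoints f m c) (hε : StepBound f m c K ε) {i j : Fin n} (hij : i < j) :
    f i (c i - ε) + f j (c j - ε) + ∑ k, f k ((K + 1) * ε) ≤ 1 := by
  have hA : f i (c i - ε) ≤ f i (c i) := (f i).mono tsub_le_self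
  have hB : f j (c j - ε) ≤ f j (c j) := (f j).mono tsub_le_self
  rcases lt_or_ge (i : ℕ) m with hi | hi
  · calc f i (c i - ε) + f j (c j - ε) + ∑ k, f k ((K + 1) * ε)
        ≤ f i (c i) + f j (c j) + (1 - (f i (c i) + f j (c j))) := by
          rw [← tsub_tsub]
          gcongr
          exact hε.notAttained i j hi hij
      _ = 1 := add_tsub_cancel_of_le (by
          rw [← ENNReal.add_halves 1]
          exact add_le_add (h.le_half i) (h.le_half j))
  · have h0 : (ε : ℝ≥0∞) ≠ 0 := by exact_mod_cast hε.pos.ne'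
    have h1 := hε.attained i j hi hij
    have h2 : ∑ k, f k ((K + 1) * ε) ≤
        (f i (c i) - f i (c i - ε)) + (f j (c j) - f j (c j - ε)) := by
      simp only [div_eq_mul_inv, ← Finset.sum_mul, ← add_mul] at h1
      exact (ENNReal.mul_le_mul_iff_left (ENNReal.inv_ne_zero.2 ENNReal.coe_ne_top)
        (ENNReal.inv_ne_top.2 h0)).1 h1
    calc f i (c i - ε) + f j (c j - ε) + ∑ k, f k ((K + 1) * ε)
        ≤ f i (c i - ε) + f j (c j - ε) +
          ((f i (c i) - f i (c i - ε)) + (f j (c j) - f j (c j - ε))) := by gcongr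
      _ = (f i (c i - ε) + (f i (c i) - f i (c i - ε))) +
          (f j (c j - ε) + (f j (c j) - f j (c j - ε))) := add_add_add_comm _ _ _ _
      _ = f i (c i) + f j (c j) := by
          rw [add_tsub_cancel_of_le hA, add_tsub_cancel_of_le hB]
      _ ≤ 1 := by
          rw [← ENNReal.add_halves 1]
          exact add_le_add (h.le_half i) (h.le_half j)

-- The Luxemburg norm and the two extreme positions

namespace MusielakOrlicz

variable {n : ℕ} {f : Fin n → YoungFunction}

instance : FiniteDimensional ℝ (MusielakOrlicz f) :=
  inferInstanceAs (FiniteDimensional ℝ (Fin n → ℝ))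

theorem norm_le_one {x : MusielakOrlicz f} (hx : (x : Fin n → ℝ) ∈ luxemburgBall f) : ‖x‖ ≤ 1 :=
  gauge_le_one_of_mem (E := Fin n → ℝ) hx

theorem mem_of_norm_lt_one {x : MusielakOrlicz f} (hx : ‖x‖ < 1) :
    (x : Fin n → ℝ) ∈ luxemburgBall f :=
  setOfPred_gauge_lt_one_subset_self (E := Fin n → ℝ) (luxemburgBall_convex f)
    (mem_of_mem_nhds (luxemburgBall_mem_nhds f)) (absorbent_nhds_zero (luxemburgBall_mem_nhds f)) hx

/-- Left-continuity makes the ball closed: `t • x` lies in it for `t < 1`, and the modular converges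
as `t` increases to `1`. -/
theorem mem_of_norm_le_one {x : MusielakOrlicz f} (hx : ‖x‖ ≤ 1) :
    (x : Fin n → ℝ) ∈ luxemburgBall f := by
  have hlim : Tendsto (fun t : ℝ≥0 => ∑ i, f i (t * ‖(x : Fin n → ℝ) i‖₊)) (𝓝[<] 1)
      (𝓝 (∑ i, f i ‖(x : Fin n → ℝ) i‖₊)) := by
    refine tendsto_finsetSum _ fun i _ => ?_
    refine ((f i).leftCont' ‖(x : Fin n → ℝ) i‖₊).tendsto.comp (tendsto_nhdsWithin_iff.2 ⟨?_, ?_⟩)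
    · refine Tendsto.mono_left ?_ nhdsWithin_le_nhds
      have : Continuous fun t : ℝ≥0 => t * ‖(x : Fin n → ℝ) i‖₊ := by fun_prop
      simpa using this.tendsto 1
    · filter_upwards [self_mem_nhdsWithin] with t ht
      exact mul_le_of_le_one_left zero_le (le_of_lt (Set.mem_Iio.1 ht))
  have : (𝓝[<] (1 : ℝ≥0)).NeBot := nhdsLT_neBot_of_exists_lt ⟨0, zero_lt_one⟩
  refine le_of_tendsto hlim ?_
  filter_upwards [self_mem_nhdsWithin] with t ht
  have h1 : ‖(t : ℝ) • x‖ < 1 := by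
    rw [norm_smul, NNReal.norm_eq]
    have ht' : (t : ℝ) < 1 := by exact_mod_cast ht
    nlinarith [norm_nonneg x, t.coe_nonneg]
  have h2 : ∑ i, f i ‖(t : ℝ) * (x : Fin n → ℝ) i‖₊ ≤ 1 := mem_of_norm_lt_one h1
  simpa [nnnorm_mul] using h2

theorem mem_smul_luxemburgBall_iff {r : ℝ} (hr : 0 < r) {x : Fin n → ℝ} :
    x ∈ r • luxemburgBall f ↔ ∑ i, f i ‖r⁻¹ * x i‖₊ ≤ 1 := by
  rw [Set.mem_smul_set_iff_inv_smul_mem₀ hr.ne']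
  rfl

theorem norm_le_norm_of_abs_le {x y : MusielakOrlicz f}
    (h : ∀ i, |(x : Fin n → ℝ) i| ≤ |(y : Fin n → ℝ) i|) : ‖x‖ ≤ ‖y‖ := by
  rw [norm_eq, norm_eq]
  refine csInf_le_csInf ⟨0, fun r hr => hr.1.le⟩
    ((absorbent_nhds_zero (luxemburgBall_mem_nhds f)).gauge_set_nonempty) ?_
  rintro r ⟨hr, hy⟩
  refine ⟨hr, (mem_smul_luxemburgBall_iff hr).2 (le_trans (Finset.sum_le_sum fun i _ =>
    (f i).mono ?_) ((mem_smul_luxemburgBall_iff hr).1 hy))⟩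
  rw [nnnorm_mul, nnnorm_mul]
  gcongr
  exact h i

theorem pairVec_apply_left {i j : Fin n} (hij : i ≠ j) (a b : ℝ) :
    (pairVec f i j a b : Fin n → ℝ) i = a := by
  change (Pi.single i a + Pi.single j b : Fin n → ℝ) i = a
  simp [hij]

theorem pairVec_apply_right {i j : Fin n} (hij : i ≠ j) (a b : ℝ) :
    (pairVec f i j a b : Fin n → ℝ) j = b := by
  change (Pi.single i a + Pi.single j b : Fin n → ℝ) j = b
  simp [hij.symm]

theorem pairVec_apply_of_ne {i j k : Fin n} (hi : k ≠ i) (hj : k ≠ j) (a b : ℝ) :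
    (pairVec f i j a b : Fin n → ℝ) k = 0 := by
  change (Pi.single i a + Pi.single j b : Fin n → ℝ) k = 0
  simp [hi, hj]

/-- The coordinate permutation as a map between Musielak–Orlicz spaces. -/
def reindex (f : Fin n → YoungFunction) (σ : Equiv.Perm (Fin n)) :
    MusielakOrlicz (f ∘ σ) →ₗ[ℝ] MusielakOrlicz f where
  toFun x := ((x : Fin n → ℝ) ∘ σ.symm : Fin n → ℝ)
  map_add' _ _ := rfl
  map_smul' _ _ := rfl

theorem norm_reindex (σ : Equiv.Perm (Fin n)) (x : MusielakOrlicz (f ∘ σ)) :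
    ‖reindex f σ x‖ = ‖x‖ := by
  rw [norm_eq, norm_eq]
  congr 1
  ext r
  refine and_congr_right fun hr => ?_
  refine (mem_smul_luxemburgBall_iff hr).trans (Iff.trans ?_ (mem_smul_luxemburgBall_iff hr).symm)
  change ∑ i, f i ‖r⁻¹ * (x : Fin n → ℝ) (σ.symm i)‖₊ ≤ 1 ↔
    ∑ i, f (σ i) ‖r⁻¹ * (x : Fin n → ℝ) i‖₊ ≤ 1
  rw [← Equiv.sum_comp σ]
  simp

/-- A tuple of coordinates as an element of the Musielak–Orlicz space. -/
def ofFun (f : Fin n → YoungFunction) : (Fin n → ℝ) →ₗ[ℝ] MusielakOrlicz f where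
  toFun x := x
  map_add' _ _ := rfl
  map_smul' _ _ := rfl

variable {m : ℕ} {c : Fin n → ℝ≥0} {K ε : ℝ≥0}

theorem one_lt_norm_pairVec (h : HalfPoints f m c) (hK : SlopeBound f m c K)
    (hε : StepBound f m c K ε) {i j : Fin n} (hij : i < j) :
    1 < ‖pairVec f i j (c i + K * ε) (c j - ε)‖ := by
  by_contra hcon
  have h1 : ∑ k, f k ‖(pairVec f i j (c i + K * ε) (c j - ε) : Fin n → ℝ) k‖₊ ≤ 1 :=
    mem_of_norm_le_one (not_lt.1 hcon)
  have hi : ‖(pairVec f i j (c i + K * ε) (c j - ε) : Fin n → ℝ) i‖₊ = c i + K * ε := by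
    rw [pairVec_apply_left hij.ne, ← NNReal.coe_inj, coe_nnnorm, Real.norm_of_nonneg (by positivity)]
    push_cast
    rfl
  have hj : ‖(pairVec f i j (c i + K * ε) (c j - ε) : Fin n → ℝ) j‖₊ = c j - ε := by
    rw [pairVec_apply_right hij.ne, ← NNReal.coe_sub (hε.lt j).le, NNReal.nnnorm_eq]
  have h2 := Finset.add_le_sum
    (f := fun k => f k ‖(pairVec f i j (c i + K * ε) (c j - ε) : Fin n → ℝ) k‖₊)
    (fun _ _ => zero_le) (Finset.mem_univ i) (Finset.mem_univ j) hij.ne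
  simp only [hi, hj] at h2
  exact absurd (one_lt_add_of_slopeBound h hK hε.pos hij (hε.lt j).le) (not_lt.2 (h2.trans h1))

theorem norm_le_one_of_stepBound (h : HalfPoints f m c) (hε : StepBound f m c K ε) {i j : Fin n}
    (hij : i < j) {w : MusielakOrlicz f} (hi : |(w : Fin n → ℝ) i| = c i - ε)
    (hj : |(w : Fin n → ℝ) j| = c j - ε)
    (hw : ∀ k, k ≠ i → k ≠ j → |(w : Fin n → ℝ) k| ≤ (K + 1) * ε) : ‖w‖ ≤ 1 := by
  refine norm_le_one ?_
  have hi' : ‖(w : Fin n → ℝ) i‖₊ = c i - ε := by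
    rw [← NNReal.coe_inj, NNReal.coe_sub (hε.lt i).le]
    exact hi
  have hj' : ‖(w : Fin n → ℝ) j‖₊ = c j - ε := by
    rw [← NNReal.coe_inj, NNReal.coe_sub (hε.lt j).le]
    exact hj
  -- The small-coordinate cost is also charged at `i` and `j`, matching the full sum in `StepBound`.
  calc ∑ k, f k ‖(w : Fin n → ℝ) k‖₊
      ≤ ∑ k, ((if k = i then f i (c i - ε) else 0) + (if k = j then f j (c j - ε) else 0) +
          f k ((K + 1) * ε)) := by
        refine Finset.sum_le_sum fun k _ => ?_
        rcases eq_or_ne k i with rfl | hki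
        · rw [hi', if_pos rfl, if_neg hij.ne, add_zero]
          exact le_self_add
        rcases eq_or_ne k j with rfl | hkj
        · rw [hj', if_pos rfl, if_neg hki, zero_add]
          exact le_self_add
        · rw [if_neg hki, if_neg hkj, add_zero, zero_add]
          exact (f k).mono (hw k hki hkj)
    _ = f i (c i - ε) + f j (c j - ε) + ∑ k, f k ((K + 1) * ε) := by
        simp [Finset.sum_add_distrib]
    _ ≤ 1 := add_sum_le_one_of_stepBound h hε hij

theorem norm_pairVec_le {i j : Fin n} (hij : i < j) (hε : StepBound f m c K ε)
    {w : MusielakOrlicz f} (hi : |(w : Fin n → ℝ) i| = c i + K * ε)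
    (hj : |(w : Fin n → ℝ) j| = c j - ε) :
    ‖pairVec f i j (c i + K * ε) (c j - ε)‖ ≤ ‖w‖ := by
  refine norm_le_norm_of_abs_le fun k => ?_
  rcases eq_or_ne k i with rfl | hki
  · rw [pairVec_apply_left hij.ne, hi, abs_of_nonneg (by positivity)]
  rcases eq_or_ne k j with rfl | hkj
  · rw [pairVec_apply_right hij.ne, hj, abs_of_nonneg]
    exact sub_nonneg.2 (by exact_mod_cast (hε.lt k).le)
  · rw [pairVec_apply_of_ne hki hkj, abs_zero]
    exact abs_nonneg _

/-- The points lie in the range of `T`, so the two-sided bound suffices and surjectivity plays no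
role. -/
theorem le_equilateralDim_of_stepBound (h : HalfPoints f m c) (hK : 0 < K)
    (hε : StepBound f m c K ε) {R : ℝ} (hR0 : 0 < R)
    (hR : ∀ i j, i < j → R ≤ ‖pairVec f i j (c i + K * ε) (c j - ε)‖)
    {Y : Type*} [NormedAddCommGroup Y] [NormedSpace ℝ Y] (T : MusielakOrlicz f →ₗ[ℝ] Y)
    (hT : ∀ x, ‖x‖ ≤ ‖T x‖ ∧ ‖T x‖ ≤ R * ‖x‖) : (n : ℕ∞) ≤ equilateralDim Y := by
  have hcε : ∀ i, (0 : ℝ) ≤ c i - ε := fun i => sub_nonneg.2 (by exact_mod_cast (hε.lt i).le)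
  have hb : (0 : ℝ) < (K + 1) * ε := mul_pos (by positivity) (by exact_mod_cast hε.pos)
  have hsum : ∀ w : Fin n → ℝ,
      ∑ k, w k • T (ofFun f (Pi.single k 1)) = T (ofFun f w) := by
    intro w
    simp only [← map_smul, ← map_sum]
    rw [← pi_eq_sum_univ' w]
  obtain ⟨p, hp⟩ := exists_forall_norm_sub_eq
    (fun k => T (ofFun f (Pi.single k 1))) (fun i => (c i - ε : ℝ)) hb (R := R)
    (fun i j hij w hi hj hk => by
      rw [hsum]
      have h1 : ‖(ofFun f w)‖ ≤ 1 := norm_le_one_of_stepBound h hε hij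
        (show |w i| = _ by rw [hi, abs_of_nonneg (hcε i)])
        (show |w j| = _ by rw [hj, abs_neg, abs_of_nonneg (hcε j)]) hk
      exact (hT _).2.trans (mul_le_of_le_one_right hR0.le h1))
    (fun i j hij w hi hj => by
      rw [hsum]
      refine (hR i j hij).trans ((norm_pairVec_le (w := ofFun f w) hij hε ?_ ?_).trans (hT _).1)
      · change |w i| = _
        rw [hi, show (c i - ε + (K + 1) * ε : ℝ) = c i + K * ε by ring,
          abs_of_nonneg (by positivity)]
      · change |w j| = _
        rw [hj, abs_neg, abs_of_nonneg (hcε j)])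
  exact le_equilateralDim_of_norm_sub_eq hR0 hp

end MusielakOrlicz

-- Ordering the coordinates, and the conclusion

theorem Fin.exists_lt_iff_of_isLowerSet {n : ℕ} {P : Fin n → Prop}
    (hP : ∀ i j, i ≤ j → P j → P i) : ∃ m : ℕ, ∀ i : Fin n, (i : ℕ) < m ↔ P i := by
  classical
  have hex : ∃ m : ℕ, ∀ i : Fin n, P i → (i : ℕ) < m := ⟨n, fun i _ => i.2⟩
  refine ⟨Nat.find hex, fun i => ⟨fun hi => ?_, Nat.find_spec hex i⟩⟩
  by_contra hn
  refine Nat.find_min hex hi fun j hj => ?_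
  by_contra hcon
  exact hn (hP i j (not_lt.1 hcon) hj)

/-- After a permutation of the coordinates, half points and a slope bound exist. -/
theorem exists_perm_halfPoints_slopeBound {n : ℕ} (f : Fin n → YoungFunction) :
    ∃ (σ : Equiv.Perm (Fin n)) (m : ℕ) (c : Fin n → ℝ≥0) (K : ℝ≥0),
      HalfPoints (f ∘ σ) m c ∧ SlopeBound (f ∘ σ) m c K := by
  classical
  choose c hc0 hc using fun i => (f i).exists_half_or_lt_half
  have hnot : ∀ i, (¬ ∃ x, f i x = 1 / 2) → f i (c i) < 1 / 2 ∧ ∀ y, c i < y → f i y = ∞ :=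
    fun i hi => (hc i).resolve_left fun h => hi ⟨_, h⟩
  have hhalf : ∀ i, (∃ x, f i x = 1 / 2) → f i (c i) = 1 / 2 := by
    rintro i ⟨x, hx⟩
    refine (hc i).resolve_right ?_
    rintro ⟨h1, h2⟩
    rcases le_or_gt x (c i) with h | h
    · exact absurd (hx ▸ (f i).mono h) (not_le.2 h1)
    · exact absurd (hx ▸ h2 x h) (by finiteness)
  -- Among attaining coordinates, infinite left derivatives come first. Then an infinite numerator
  -- in `SlopeBound` meets an infinite denominator, whose quotient is `0`, and all quotients are
  -- finite.
  let key : Fin n → ℕ := fun i =>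
    if ∃ x, f i x = 1 / 2 then (if (f i).leftDeriv (c i) = ∞ then 1 else 2) else 0
  have hkey0 : ∀ i, key i = 0 ↔ ¬ ∃ x, f i x = 1 / 2 := by
    intro i
    simp only [key]
    split_ifs <;> simp_all
  let σ := Tuple.sort key
  have hσ : Monotone (key ∘ σ) := Tuple.monotone_sort key
  obtain ⟨m, hm⟩ := Fin.exists_lt_iff_of_isLowerSet (P := fun i => key (σ i) = 0)
    fun i j hij hj => Nat.le_zero.1 ((hσ hij).trans hj.le)
  have hatt : ∀ i : Fin n, m ≤ (i : ℕ) → ∃ x, f (σ i) x = 1 / 2 := fun i hi => by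
    by_contra hcon
    exact absurd ((hm i).2 ((hkey0 _).2 hcon)) (not_lt.2 hi)
  have hquot : ∀ i j : Fin n, m ≤ (i : ℕ) → i < j →
      (f (σ j)).leftDeriv (c (σ j)) / (f (σ i)).rightDeriv (c (σ i)) ≠ ∞ := by
    intro i j hi hij
    have hai := hatt i hi
    have haj := hatt j (hi.trans (by exact_mod_cast hij.le))
    have hfi : f (σ i) (c (σ i)) ≠ ∞ := by
      rw [hhalf _ hai]
      finiteness
    have hle := (f (σ i)).leftDeriv_le_rightDeriv hfi (hc0 _)
    have hpos := (f (σ i)).leftDeriv_pos hfi (by rw [hhalf _ hai]; simp) (hc0 _)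
    rcases eq_or_ne ((f (σ j)).leftDeriv (c (σ j))) ∞ with hj | hj
    · have h1 : key (σ i) ≤ key (σ j) := hσ hij.le
      have h2 : (f (σ i)).leftDeriv (c (σ i)) = ∞ := by
        by_contra hcon
        simp only [key, if_pos hai, if_pos haj, if_pos hj, if_neg hcon] at h1
        omega
      rw [h2, top_le_iff] at hle
      rw [hle, ENNReal.div_top]
      exact ENNReal.zero_ne_top
    · exact ENNReal.div_ne_top hj (hpos.trans_le hle).ne'
  let q : Fin n → Fin n → ℝ≥0 := fun i j =>
    ((f (σ j)).leftDeriv (c (σ j)) / (f (σ i)).rightDeriv (c (σ i))).toNNReal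
  refine ⟨σ, m, c ∘ σ, 1 + ∑ i, ∑ j, q i j, ⟨fun i => ?_, fun i hi => ?_, fun i hi => ?_⟩,
    by positivity, fun i j hi hij => ?_⟩
  · exact (hm i).trans (hkey0 _)
  · obtain ⟨h1, h2⟩ := hnot _ ((hkey0 _).1 ((hm i).1 hi))
    refine ⟨fun x hx => ?_, fun b hb => hb (show f (σ i) (c (σ i)) < ∞ from h1.trans (by finiteness))⟩
    by_contra hcon
    exact absurd (h2 x (not_le.1 hcon)) (ne_of_lt hx)
  · exact hhalf _ (hatt i hi)
  · change (f (σ j)).leftDeriv (c (σ j)) / (f (σ i)).rightDeriv (c (σ i)) < _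
    rw [← ENNReal.coe_toNNReal (hquot i j hi hij), ENNReal.coe_lt_coe]
    calc q i j ≤ ∑ j, q i j := Finset.single_le_sum (fun _ _ => zero_le) (Finset.mem_univ j)
      _ ≤ ∑ i, ∑ j, q i j :=
        Finset.single_le_sum (f := fun i => ∑ j, q i j) (fun _ _ => zero_le) (Finset.mem_univ i)
      _ < 1 + ∑ i, ∑ j, q i j := lt_add_of_pos_left _ zero_lt_one

theorem exists_isLeast_norm_pairVec {n : ℕ} (hn : 2 ≤ n) (f : Fin n → YoungFunction)
    (a b : Fin n → ℝ) :
    ∃ R, IsLeast {r : ℝ | ∃ i j : Fin n, i < j ∧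
      r = ‖MusielakOrlicz.pairVec f i j (a i) (b j)‖} R := by
  have hfin : {r : ℝ | ∃ i j : Fin n, i < j ∧
      r = ‖MusielakOrlicz.pairVec f i j (a i) (b j)‖}.Finite := by
    refine (Set.finite_range fun q : Fin n × Fin n =>
      ‖MusielakOrlicz.pairVec f q.1 q.2 (a q.1) (b q.2)‖).subset ?_
    rintro _ ⟨i, j, -, rfl⟩
    exact ⟨(i, j), rfl⟩
  obtain ⟨R, hR, hmin⟩ := Set.exists_min_image _ id hfin
    ⟨_, ⟨0, by omega⟩, ⟨1, by omega⟩, by simp, rfl⟩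
  exact ⟨R, hR, fun r hr => hmin r hr⟩

theorem theorem1p7 (n : ℕ) (f : Fin n → YoungFunction) (hf : ∀ i, (f i).DerivZero) :
    (∃ R : ℝ, 1 < R ∧
      ∀ (Y : Type u) [NormedAddCommGroup Y] [NormedSpace ℝ Y],
        banachMazurDist (MusielakOrlicz f) Y ≤ ENNReal.ofReal R →
          (n : ℕ∞) ≤ equilateralDim Y) ∧
    ∀ (m : ℕ) (c : Fin n → ℝ≥0) (K : ℝ≥0), HalfPoints f m c → SlopeBound f m c K →
      (∃ ε₀ : ℝ≥0, StepBound f m c K ε₀) ∧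
      ∀ ε₀ : ℝ≥0, StepBound f m c K ε₀ →
        ∀ R : ℝ,
          IsLeast {r : ℝ | ∃ i j : Fin n, i < j ∧
            r = ‖MusielakOrlicz.pairVec f i j (c i + K * ε₀) (c j - ε₀)‖} R →
          1 < R ∧
          ∀ (Y : Type u) [NormedAddCommGroup Y] [NormedSpace ℝ Y],
            banachMazurDist (MusielakOrlicz f) Y ≤ ENNReal.ofReal R →
              (n : ℕ∞) ≤ equilateralDim Y := by
  constructor
  · rcases lt_or_ge n 2 with hn | hn
    · refine ⟨2, one_lt_two, fun Y _ _ _ => ?_⟩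
      -- For `n < 2` there are no pairs `i < j`, so any family will do.
      refine le_equilateralDim_of_norm_sub_eq (p := fun _ => (0 : Y)) one_pos fun i j hij => ?_
      have := j.2
      rw [Fin.lt_def] at hij
      omega
    obtain ⟨σ, m, c, K, h, hK⟩ := exists_perm_halfPoints_slopeBound f
    obtain ⟨ε, hε⟩ := h.exists_stepBound (fun i => hf (σ i)) K
    obtain ⟨R, hR⟩ := exists_isLeast_norm_pairVec hn (f ∘ σ) (fun i => c i + K * ε)
      (fun j => c j - ε)
    have hR1 : 1 < R := by
      obtain ⟨i, j, hij, rfl⟩ := hR.1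
      exact MusielakOrlicz.one_lt_norm_pairVec h hK hε hij
    refine ⟨R, hR1, fun Y _ _ hd => ?_⟩
    have hR0 : 0 < R := one_pos.trans hR1
    obtain ⟨T, hT⟩ := exists_clm_of_banachMazurDist_le hR0.le hd
    refine MusielakOrlicz.le_equilateralDim_of_stepBound h hK.1 hε hR0
      (fun i j hij => hR.2 ⟨i, j, hij, rfl⟩)
      ((T : MusielakOrlicz f →ₗ[ℝ] Y) ∘ₗ MusielakOrlicz.reindex f σ) fun x => ?_
    rw [← MusielakOrlicz.norm_reindex σ x]
    exact hT _
  · intro m c K h hK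
    refine ⟨h.exists_stepBound hf K, fun ε hε R hR => ?_⟩
    -- A least element forces the set of pair norms to be nonempty, hence `n ≥ 2`.
    have hR1 : 1 < R := by
      obtain ⟨i, j, hij, rfl⟩ := hR.1
      exact MusielakOrlicz.one_lt_norm_pairVec h hK hε hij
    refine ⟨hR1, fun Y _ _ hd => ?_⟩
    have hR0 : 0 < R := one_pos.trans hR1
    obtain ⟨T, hT⟩ := exists_clm_of_banachMazurDist_le hR0.le hd
    exact MusielakOrlicz.le_equilateralDim_of_stepBound h hK.1 hε hR0
      (fun i j hij => hR.2 ⟨i, j, hij, rfl⟩) (T : MusielakOrlicz f →ₗ[ℝ] Y) hT
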